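/- For $n\ge 2$ and real numbers $c_0,\dots,c_{n-1}$ let $f(\lambda)=\lambda_1\cdots\lambda_n-\sum_{k=0}^{n-1}c_k\sigma_k(\lambda)$ on $\mathbb{R}^n$, where $\sigma_k$ is the $k$-th elementary symmetric polynomial ($\sigma_0=1$). Let $\Gamma_n=\{\lambda\in\mathbb{R}^n:\lambda_i>0\text{ for all }i\}$ be the positive orthant. By the level set of the equation $f=0$ we mean the connected component of $\{f=0\}$ that is contained in $q+\Gamma_n$ for some $q\in\mathbb{R}^n$. We say that the equation $f=0$ has convex level set if there is exactly one such component $L$, and $L$ is the boundary of a connected component of $\{f>0\}$ which is convex and is contained in $q+\Gamma_n$ for some $q\in\mathbb{R}^n$. Proposition 4.1. The following equations have convex level set. (1) $\lambda_1\lambda_2-c_0=0$, where $c_0>0$. (2) $\lambda_1\lambda_2\lambda_3-c_1(\lambda_1+\lambda_2+\lambda_3)-c_0=0$, where $c_1\ge 0$ and $c_0>-2c_1^{3/2}$. (3) $\lambda_1\lambda_2\lambda_3\lambda_4-c_2\sigma_2(\lambda)-c_1\sigma_1(\lambda)-c_0=0$, where $c_2\ge 0$, $c_1\ge -2c_2^{3/2}$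 and $c_0>-3c_2x_1^2-3c_1x_1$. Here $$x_1=\begin{cases}\sqrt[3]{c_1}, & c_2=0,\\ 2\sqrt{c_2}\,\cos\Bigl[\tfrac13\arccos\Bigl(\tfrac{c_1}{2c_2^{3/2}}\Bigr)\Bigr], & c_2>0,\ 4c_2^3-c_1^2\ge 0,\\ 2\sqrt{c_2}\,\cosh\Bigl[\tfrac13\operatorname{arccosh}\Bigl(\tfrac{c_1}{2c_2^{3/2}}\Bigr)\Bigr], & c_1,c_2>0,\ 4c_2^3-c_1^2\le 0,\end{cases}$$ with $\arccos$ valued in $[0,\pi]$ and $\operatorname{arccosh}\ge 0$. Moreover, whenever $c_2\ge 0$ and $c_1\ge -2c_2^{3/2}$, $x_1$ is the largest real root of $x^3-3c_2x-c_1$. -/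

import Mathlib

/-- The `k`-th elementary symmetric polynomial `σ_k(l₁, …, lₙ)`, with `σ_0 = 1`. -/
noncomputable def sigmaSymm {n : ℕ} (k : ℕ) (l : Fin n → ℝ) : ℝ :=
  MvPolynomial.eval l (MvPolynomial.esymm (Fin n) ℝ k)

/-- The general inverse `σ_k` type multilinear polynomial
`f(l) = l₁ ⋯ lₙ - ∑_{k = 0}^{n - 1} c_k σ_k(l)` with coefficients `c = (c_0, …, c_{n-1})`. -/
noncomputable def invSigma {n : ℕ} (c : Fin n → ℝ) (l : Fin n → ℝ) : ℝ :=
  (∏ i, l i) - ∑ k : Fin n, c k * sigmaSymm (k : ℕ) l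

/-- The translate `q + Γₙ` of the positive orthant `Γₙ = {l : l_i > 0 for all i}`. -/
def translatedOrthant {n : ℕ} (q : Fin n → ℝ) : Set (Fin n → ℝ) :=
  {l | ∀ i, q i < l i}

/-- `C` is a connected component of the set `S`. -/
def IsConnectedComponentOf {X : Type*} [TopologicalSpace X] (C S : Set X) : Prop :=
  ∃ x ∈ S, C = connectedComponentIn S x

/-- `L` is a level set of the equation `f = 0`: the zero set `{f = 0}` is in general
disconnected, and what is meant is a connected component of it that is contained in
`q + Γₙ` for some `q`. -/
def IsLevelSetOf {n : ℕ} (f : (Fin n → ℝ) → ℝ) (L : Set (Fin n → ℝ)) : Prop :=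
  IsConnectedComponentOf L {l | f l = 0} ∧ ∃ q, L ⊆ translatedOrthant q

/-- The hypersurface `L ⊆ {f = 0}` is convex: it is the whole boundary of its enclosed region,
a connected component of `{f > 0}` contained in `q + Γₙ` for some `q`,
and this region is a convex set. -/
def IsConvexLevelSet {n : ℕ} (f : (Fin n → ℝ) → ℝ) (L : Set (Fin n → ℝ)) : Prop :=
  ∃ G : Set (Fin n → ℝ), IsConnectedComponentOf G {l | 0 < f l} ∧
    (∃ q, G ⊆ translatedOrthant q) ∧ frontier G = L ∧ Convex ℝ G

/-- The level set of the equation `f = 0` is well defined (it exists and is unique),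
and it is convex. -/
def HasConvexLevelSet {n : ℕ} (f : (Fin n → ℝ) → ℝ) : Prop :=
  (∃! L, IsLevelSetOf f L) ∧ ∀ L, IsLevelSetOf f L → IsConvexLevelSet f L

/-- The trigonometric / hyperbolic expression for the largest real root of
`x³ - 3 c₂ x - c₁`. It is used for `c₂ ≥ 0` and `c₁ ≥ -2 c₂^{3/2}` only: then `c₁ ≥ 0` in the
first branch, and `c₁ > 0`, `c₂ > 0` in the third one. In the common boundary case
`c₁ = 2 c₂^{3/2}` of the last two branches both formulas give `2 √c₂`. -/
noncomputable def cubicRoot (c₁ c₂ : ℝ) : ℝ :=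
  if c₂ = 0 then c₁ ^ (1 / 3 : ℝ)
  else if 0 ≤ 4 * c₂ ^ 3 - c₁ ^ 2 then
    2 * √c₂ * Real.cos (1 / 3 * Real.arccos (c₁ / (2 * c₂ ^ (3 / 2 : ℝ))))
  else
    2 * √c₂ * Real.cosh (1 / 3 * Real.arcosh (c₁ / (2 * c₂ ^ (3 / 2 : ℝ))))

/-!
Through any point of a level set, the part in a coordinate plane is a hyperbola; on its upper
branch (the lower one is excluded by `L ⊆ q + Γₙ`) one can increase a coordinate at will or move to
the vertex. The former leads into an open region `P` on whose closure `f ≥ 0` forces membership in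
`P`, so that all components of `{f = 0}` and of `{f > 0}` meeting `P` lie in `P`. The latter shows
that a minimiser of `∑ lᵢ` on the level set is a diagonal point, of which `P` contains only one zero
of `f`, whence uniqueness. It remains to see that `P ∩ {f > 0}` is convex.

In degree three this is the convexity of `z = (g² (x + y) + c₀) / (x y - g²)`. In degree four the
part over `(x, y)` is the inside of a hyperbola in `(z, w)` whose centre depends convexly on
`(x, y)`; this reduces convexity, by Cauchy–Schwarz, to the slice `z = w`, and applied twice to the
slice `x = y`, `z = w`. There, a line of negative slope leaving and re-entering the region would
carry a quartic polynomial with positive leading coefficient and the alternating signs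
`-, +, ≤ 0, +, -` at five points, which is impossible. The hypothesis on `c₀` says that the region
stays inside the one cut out by the cubics that are the partial derivatives of `f`.
-/

open Function in
/-- In the plane of the coordinates `i` and `j` through the point `l`, the function `f` is the
symmetric multiaffine polynomial `A x y + B (x + y) + C`: its zero set in that plane is a
hyperbola with centre `(-B / A, -B / A)` if `A ≠ 0`. -/
def PairForm {n : ℕ} (f : (Fin n → ℝ) → ℝ) (i j : Fin n) (l : Fin n → ℝ) (A B C : ℝ) : Prop :=
  ∀ x y, f (update (update l i x) j y) = A * (x * y) + B * (x + y) + C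

section InvSigma

open Function Filter Polynomial

variable {n : ℕ}

theorem sigmaSymm_eq_coeff {k : ℕ} (hk : k ≤ n) (l : Fin n → ℝ) :
    sigmaSymm k l = (∏ i, (X + C (l i))).coeff (n - k) := by
  rw [Finset.prod_X_add_C_coeff _ _ (by simp)]
  simp [sigmaSymm, MvPolynomial.esymm, Nat.sub_sub_self hk]

/-- The linear functional on polynomials whose value at `∏ i, (X + l i)` is `invSigma c l`. -/
noncomputable def invSigmaFunctional (c : Fin n → ℝ) : ℝ[X] →ₗ[ℝ] ℝ :=
  lcoeff ℝ 0 - ∑ k : Fin n, c k • lcoeff ℝ (n - k)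

theorem invSigma_eq_invSigmaFunctional (c l : Fin n → ℝ) :
    invSigma c l = invSigmaFunctional c (∏ i, (X + C (l i))) := by
  have hprod : (∏ i, (X + C (l i))).coeff 0 = ∏ i, l i := by
    simp [coeff_zero_eq_eval_zero, eval_prod]
  simp [invSigma, invSigmaFunctional, LinearMap.sum_apply, hprod,
    fun k : Fin n => sigmaSymm_eq_coeff k.isLt.le l]

theorem continuous_invSigma (c : Fin n → ℝ) : Continuous (invSigma c) := by
  unfold invSigma sigmaSymm
  have (k : ℕ) := MvPolynomial.continuous_eval (MvPolynomial.esymm (Fin n) ℝ k)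
  fun_prop

theorem exists_pairForm_invSigma (c : Fin n → ℝ) {i j : Fin n} (hij : i ≠ j) (l : Fin n → ℝ) :
    ∃ A B C, PairForm (invSigma c) i j l A B C := by
  set R : ℝ[X] := ∏ k ∈ (Finset.univ.erase j).erase i, (X + C (l k))
  refine ⟨invSigmaFunctional c R, invSigmaFunctional c (X * R), invSigmaFunctional c (X ^ 2 * R),
    fun x y => ?_⟩
  have hfactor : ∏ k, (X + C (update (update l i x) j y k)) = (X + C y) * ((X + C x) * R) := by
    rw [← Finset.mul_prod_erase _ _ (Finset.mem_univ j),
      ← Finset.mul_prod_erase _ _ (Finset.mem_erase.2 ⟨hij, Finset.mem_univ i⟩)]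
    simp only [update_self, update_of_ne hij]
    congr 2
    refine Finset.prod_congr rfl fun k hk => ?_
    simp only [Finset.mem_erase] at hk
    rw [update_of_ne hk.2.1, update_of_ne hk.1]
  have hexpand : (X + C y) * ((X + C x) * R) =
      (x * y) • R + (x + y) • (X * R) + X ^ 2 * R := by
    simp only [smul_eq_C_mul, C_mul, C_add]
    ring
  rw [invSigma_eq_invSigmaFunctional, hfactor, hexpand]
  simp only [map_add, map_smul, smul_eq_mul]
  ring

theorem tendsto_invSigma_diagonal [NeZero n] (c : Fin n → ℝ) :
    Tendsto (fun t => invSigma c fun _ => t) atTop atTop := by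
  set p : ℝ[X] := ∑ k : Fin n, C (c k * n.choose (n - k)) * X ^ (k : ℕ) with hp
  have hdeg : p.degree < n := degree_sum_fin_lt _
  have heval : (fun t => invSigma c fun _ => t) = fun t => (X ^ n - p).eval t := by
    funext t
    rw [invSigma_eq_invSigmaFunctional]
    have hcoeff (k : Fin n) : n - (n - (k : ℕ)) = k := Nat.sub_sub_self k.isLt.le
    simp only [invSigmaFunctional, Finset.prod_const, Finset.card_univ, Fintype.card_fin,
      LinearMap.sub_apply, lcoeff_apply, coeff_X_add_C_pow, LinearMap.sum_apply,
      LinearMap.smul_apply, smul_eq_mul, hcoeff, hp, eval_sub, eval_pow, eval_X,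
      eval_finsetSum, eval_mul, eval_C, tsub_zero, Nat.choose_zero_right, Nat.cast_one, mul_one]
    congr 1
    exact Finset.sum_congr rfl fun k _ => by ring
  have hdegree : (X ^ n - p).degree = (n : WithBot ℕ) := by
    rw [degree_sub_eq_left_of_degree_lt (by rwa [degree_X_pow]), degree_X_pow]
  rw [heval]
  refine tendsto_atTop_of_leadingCoeff_nonneg _ ?_ ?_
  · rw [hdegree]
    exact_mod_cast NeZero.pos n
  · rw [(monic_X_pow_sub hdeg).leadingCoeff]
    exact zero_le_one

end InvSigma

section LevelSets

open Function Filter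

variable {n : ℕ} {f : (Fin n → ℝ) → ℝ} {L : Set (Fin n → ℝ)} {i j : Fin n} {l : Fin n → ℝ}
  {A B C : ℝ}

theorem IsConnectedComponentOf.mem_of_path {X : Type*} [TopologicalSpace X] {C S : Set X}
    (hC : IsConnectedComponentOf C S) {T : Set ℝ} (hT : IsPreconnected T) {γ : ℝ → X}
    (hγ : ContinuousOn γ T) (hS : ∀ t ∈ T, γ t ∈ S) {s t : ℝ} (hs : s ∈ T) (hsC : γ s ∈ C)
    (ht : t ∈ T) : γ t ∈ C := by
  obtain ⟨x, -, rfl⟩ := hC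
  rw [connectedComponentIn_eq hsC]
  exact (hT.image γ hγ).subset_connectedComponentIn (Set.mem_image_of_mem γ hs)
    (Set.image_subset_iff.2 hS) (Set.mem_image_of_mem γ ht)

theorem IsConnectedComponentOf.isClosed {X : Type*} [TopologicalSpace X] {C S : Set X}
    (hC : IsConnectedComponentOf C S) (hS : IsClosed S) : IsClosed C := by
  obtain ⟨x, hx, rfl⟩ := hC
  exact isClosed_of_closure_subset <|
    isPreconnected_connectedComponentIn.closure.subset_connectedComponentIn
      (subset_closure (mem_connectedComponentIn hx))
      (closure_minimal (connectedComponentIn_subset _ _) hS)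

theorem IsLevelSetOf.eq_zero (hL : IsLevelSetOf f L) (hl : l ∈ L) : f l = 0 := by
  obtain ⟨⟨z, -, rfl⟩, -⟩ := hL
  exact connectedComponentIn_subset {l | f l = 0} z hl

theorem IsLevelSetOf.nonempty (hL : IsLevelSetOf f L) : L.Nonempty := by
  obtain ⟨⟨z, hz, rfl⟩, -⟩ := hL
  exact ⟨z, mem_connectedComponentIn hz⟩

theorem IsLevelSetOf.isPreconnected (hL : IsLevelSetOf f L) : IsPreconnected L := by
  obtain ⟨⟨z, -, rfl⟩, -⟩ := hL
  exact isPreconnected_connectedComponentIn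

theorem IsLevelSetOf.exists_coord_lt (hL : IsLevelSetOf f L) (i : Fin n) :
    ∃ q, ∀ l ∈ L, q < l i := by
  obtain ⟨q, hq⟩ := hL.2
  exact ⟨q i, fun l hl => hq hl i⟩

theorem PairForm.swap (h : PairForm f i j l A B C) (hij : i ≠ j) : PairForm f j i l A B C := by
  intro x y
  rw [update_comm hij.symm, h]
  ring

theorem PairForm.eval_self (h : PairForm f i j l A B C) :
    f l = A * (l i * l j) + B * (l i + l j) + C := by
  simpa using h (l i) (l j)

theorem IsLevelSetOf.update_mem_of_path (hL : IsLevelSetOf f L) (hl : l ∈ L)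
    (h : PairForm f i j l A B C) {T : Set ℝ} (hT : IsPreconnected T) {x y : ℝ → ℝ}
    (hx : ContinuousOn x T) (hy : ContinuousOn y T)
    (hxy : ∀ t ∈ T, A * (x t * y t) + B * (x t + y t) = A * (l i * l j) + B * (l i + l j))
    {s t : ℝ} (hs : s ∈ T) (hxs : x s = l i) (hys : y s = l j) (ht : t ∈ T) :
    update (update l i (x t)) j (y t) ∈ L := by
  refine hL.1.mem_of_path hT (γ := fun t => update (update l i (x t)) j (y t))
    (fun t ht => ((continuousWithinAt_const (b := l)).update i (hx t ht)).update j (hy t ht))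
    ?_ hs ?_ ht
  · intro t ht
    change f _ = 0
    rw [h, hxy t ht, ← h.eval_self, hL.eq_zero hl]
  · simpa [hxs, hys] using hl

theorem IsLevelSetOf.update_mem_of_mul_eq (hL : IsLevelSetOf f L) (hl : l ∈ L)
    (h : PairForm f i j l A B C) (hA : A ≠ 0) {p q : ℝ} (hp : 0 < p * (l i + B / A))
    (hpq : p * q = (l i + B / A) * (l j + B / A)) :
    update (update l i (p - B / A)) j (q - B / A) ∈ L := by
  set u := l i + B / A with hu
  set v := l j + B / A with hv
  have hu0 : u ≠ 0 := fun h0 => by simp [h0] at hp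
  have hp0 : p ≠ 0 := fun h0 => by simp [h0] at hp
  have hne : ∀ t ∈ {t | 0 < t * u}, t ≠ 0 := fun t ht h0 => by simp [h0] at ht
  have hT : IsPreconnected {t | 0 < t * u} :=
    ((convex_Ioi (0 : ℝ)).linear_preimage (LinearMap.mulRight ℝ u)).isPreconnected
  have hmem := hL.update_mem_of_path hl h hT (x := fun t => t - B / A)
    (y := fun t => u * v / t - B / A) (by fun_prop)
    ((continuousOn_const.div continuousOn_id hne).sub continuousOn_const) ?_ (s := u)
    (mul_self_pos.2 hu0) (by simp [hu]) ?_ hp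
  · rwa [← hpq, mul_div_cancel_left₀ q hp0] at hmem
  · intro t ht
    have := hne t ht
    rw [hu, hv]
    field_simp
    ring
  · rw [mul_div_cancel_left₀ v hu0, hv, add_sub_cancel_right]

theorem IsLevelSetOf.leading_ne_zero (hL : IsLevelSetOf f L) (hl : l ∈ L)
    (h : PairForm f i j l A B C) : A ≠ 0 := by
  rintro rfl
  obtain ⟨q, hq⟩ := hL.exists_coord_lt j
  have hmem := hL.update_mem_of_path hl h isPreconnected_univ
    (x := fun s => l i + s) (y := fun s => l j - s) (by fun_prop) (by fun_prop)
    (fun t _ => by ring) (s := 0) trivial (by simp) (by simp) (t := l j - q) trivial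
  simpa using hq _ hmem

theorem IsLevelSetOf.upper_branch (hL : IsLevelSetOf f L) (hij : i ≠ j) (hl : l ∈ L)
    (h : PairForm f i j l A B C) : 0 < l i + B / A := by
  have hA := hL.leading_ne_zero hl h
  rcases lt_trichotomy (l i + B / A) 0 with hneg | hzero | hpos
  · obtain ⟨q, hq⟩ := hL.exists_coord_lt i
    set p := min (l i + B / A) (q + B / A)
    have hp : p < 0 := (min_le_left _ _).trans_lt hneg
    have hmem := hq _ <| hL.update_mem_of_mul_eq hl h hA (mul_pos_of_neg_of_neg hp hneg)
      (mul_div_cancel₀ _ hp.ne)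
    rw [update_of_ne hij, update_self] at hmem
    linarith [min_le_right (l i + B / A) (q + B / A)]
  · obtain ⟨q, hq⟩ := hL.exists_coord_lt j
    have hB : B = -(A * l i) := by
      field_simp at hzero
      linarith
    have hmem := hL.update_mem_of_path hl h isPreconnected_univ
      (x := fun _ => l i) (y := fun s => l j - s) (by fun_prop) (by fun_prop)
      (fun t _ => by rw [hB]; ring) (s := 0) trivial (by simp) (by simp) (t := l j - q) trivial
    simpa using hq _ hmem
  · exact hpos

theorem IsLevelSetOf.leading_mul_pos (hL : IsLevelSetOf f L) (hij : i ≠ j) (hl : l ∈ L)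
    (h : PairForm f i j l A B C) : 0 < A * (A * l i + B) := by
  have hA := hL.leading_ne_zero hl h
  have hfactor : A * (A * l i + B) = A ^ 2 * (l i + B / A) := by field_simp
  rw [hfactor]
  exact mul_pos (by positivity) (hL.upper_branch hij hl h)

theorem IsLevelSetOf.exists_update_mem_of_lt (hL : IsLevelSetOf f L) (hij : i ≠ j) (hl : l ∈ L)
    (h : PairForm f i j l A B C) (M : ℝ) : ∃ x y, M < x ∧ update (update l i x) j y ∈ L := by
  have hpos := hL.upper_branch hij hl h
  set p := max (l i + B / A) (M + 1 + B / A)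
  have hp : 0 < p := hpos.trans_le (le_max_left _ _)
  refine ⟨p - B / A, _, ?_, hL.update_mem_of_mul_eq hl h (hL.leading_ne_zero hl h)
    (mul_pos hp hpos) (mul_div_cancel₀ _ hp.ne')⟩
  linarith [le_max_right (l i + B / A) (M + 1 + B / A)]

theorem sum_update_update (hij : i ≠ j) (l : Fin n → ℝ) (x y : ℝ) :
    ∑ k, update (update l i x) j y k = ∑ k, l k + (x - l i) + (y - l j) := by
  have hupdate (l : Fin n → ℝ) (i : Fin n) (x : ℝ) :
      ∑ k, update l i x k = ∑ k, l k + (x - l i) := by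
    rw [Finset.sum_update_of_mem (Finset.mem_univ i), Finset.sum_eq_add_sum_sdiff_singleton_of_mem
      (Finset.mem_univ i) l]
    ring
  rw [hupdate, hupdate, update_of_ne hij.symm]

theorem IsLevelSetOf.exists_isMinOn_sum (hf : Continuous f) (hL : IsLevelSetOf f L) :
    ∃ m ∈ L, IsMinOn (fun l => ∑ i, l i) L m := by
  have hclosed : IsClosed L := hL.1.isClosed (isClosed_eq hf continuous_const)
  obtain ⟨z, hz⟩ := hL.nonempty
  obtain ⟨q, hq⟩ := hL.2
  refine (continuous_finsetSum _ fun i _ => continuous_apply i).continuousOn.exists_isMinOn'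
    hclosed hz ?_
  have hbox : (Set.Icc q fun i => q i + (∑ i, z i - ∑ i, q i))ᶜ ∈ cocompact (Fin n → ℝ) :=
    isCompact_Icc.compl_mem_cocompact
  filter_upwards [mem_inf_of_left hbox, mem_inf_of_right (mem_principal_self L)] with l hout hl
  contrapose! hout
  refine not_not.2 ⟨fun i => (hq hl i).le, fun i => ?_⟩
  have hi : l i - q i ≤ ∑ i, (l i - q i) :=
    Finset.single_le_sum (f := fun i => l i - q i) (fun k _ => sub_nonneg.2 (hq hl k).le)
      (Finset.mem_univ i)
  rw [Finset.sum_sub_distrib] at hi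
  dsimp only
  linarith

-- Otherwise moving along the hyperbola to its vertex would decrease the sum.
theorem IsLevelSetOf.eq_of_isMinOn_sum (hL : IsLevelSetOf f L) (hl : l ∈ L)
    (hmin : IsMinOn (fun l => ∑ i, l i) L l) (hij : i ≠ j) (h : PairForm f i j l A B C) :
    l i = l j := by
  have hu := hL.upper_branch hij hl h
  have hv := hL.upper_branch hij.symm hl (h.swap hij)
  set u := l i + B / A
  set v := l j + B / A
  have hvertex := isMinOn_iff.1 hmin _ <| hL.update_mem_of_mul_eq hl h (hL.leading_ne_zero hl h)
    (p := √(u * v)) (q := √(u * v)) (by positivity) (Real.mul_self_sqrt (by positivity))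
  rw [sum_update_update hij, Real.sqrt_mul hu.le] at hvertex
  have hsq : (√u - √v) ^ 2 ≤ 0 := by
    linarith [Real.sq_sqrt hu.le, Real.sq_sqrt hv.le, sub_sq (√u) (√v)]
  have hroot : √u = √v := sub_eq_zero.1 (pow_eq_zero_iff two_ne_zero |>.1
    (le_antisymm hsq (sq_nonneg _)))
  linarith [(Real.sqrt_inj hu.le hv.le).1 hroot]

theorem IsLevelSetOf.exists_diagonal [NeZero n] (hf : Continuous f) (hL : IsLevelSetOf f L)
    (hpair : ∀ i j, i ≠ j → ∀ l, ∃ A B C, PairForm f i j l A B C) : ∃ t : ℝ, (fun _ => t) ∈ L := by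
  obtain ⟨m, hm, hmin⟩ := hL.exists_isMinOn_sum hf
  refine ⟨m 0, ?_⟩
  convert hm using 1
  funext i
  by_cases hi : 0 = i
  · rw [hi]
  · obtain ⟨A, B, C, h⟩ := hpair 0 i hi m
    exact hL.eq_of_isMinOn_sum hm hmin hi h

/-- A region of the positive orthant holding whole connected components of `{f = 0}` and of
`{0 < f}`, in which moving diagonally leads from the former to the latter. -/
structure IsGrowthRegion (f : (Fin n → ℝ) → ℝ) (P : Set (Fin n → ℝ)) : Prop where
  isOpen : IsOpen P
  mem_of_mem_closure : ∀ l ∈ closure P, 0 ≤ f l → l ∈ P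
  subset_orthant : P ⊆ translatedOrthant 0
  lt_add : ∀ l ∈ P, ∀ s > 0, f l < f fun i => l i + s

variable {P : Set (Fin n → ℝ)}

theorem IsGrowthRegion.subset_of_isPreconnected (hP : IsGrowthRegion f P) {S : Set (Fin n → ℝ)}
    (hS : IsPreconnected S) (hf : ∀ l ∈ S, 0 ≤ f l) (hSP : (S ∩ P).Nonempty) : S ⊆ P :=
  hS.subset_of_closure_inter_subset hP.isOpen hSP fun l hl =>
    hP.mem_of_mem_closure l hl.1 (hf l hl.2)

theorem IsGrowthRegion.subset_of_isLevelSetOf (hP : IsGrowthRegion f P) (hL : IsLevelSetOf f L)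
    (hLP : (L ∩ P).Nonempty) : L ⊆ P :=
  hP.subset_of_isPreconnected hL.isPreconnected (fun _ hl => (hL.eq_zero hl).ge) hLP

theorem IsGrowthRegion.isLevelSetOf (hP : IsGrowthRegion f P) (hl : l ∈ P) (h0 : f l = 0) :
    IsLevelSetOf f (connectedComponentIn {l | f l = 0} l) :=
  ⟨⟨l, h0, rfl⟩, 0, (hP.subset_of_isPreconnected isPreconnected_connectedComponentIn
    (fun _ hk => (connectedComponentIn_subset {l | f l = 0} l hk).ge)
    ⟨l, mem_connectedComponentIn h0, hl⟩).trans hP.subset_orthant⟩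

theorem IsGrowthRegion.le_of_diagonal_zero (hP : IsGrowthRegion f P) {s t : ℝ}
    (hs : (fun _ => s) ∈ P) (hs0 : f (fun _ => s) = 0) (ht0 : f (fun _ => t) = 0) : t ≤ s := by
  by_contra! hst
  have := hP.lt_add _ hs (t - s) (sub_pos.2 hst)
  simp only [add_sub_cancel] at this
  linarith

theorem IsGrowthRegion.eq_of_isLevelSetOf [NeZero n] (hP : IsGrowthRegion f P) (hf : Continuous f)
    (hpair : ∀ i j, i ≠ j → ∀ l, ∃ A B C, PairForm f i j l A B C)
    {L' : Set (Fin n → ℝ)} (hL : IsLevelSetOf f L) (hL' : IsLevelSetOf f L') (hLP : L ⊆ P)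
    (hLP' : L' ⊆ P) : L = L' := by
  obtain ⟨t, ht⟩ := hL.exists_diagonal hf hpair
  obtain ⟨t', ht'⟩ := hL'.exists_diagonal hf hpair
  obtain rfl : t = t' := le_antisymm
    (hP.le_of_diagonal_zero (hLP' ht') (hL'.eq_zero ht') (hL.eq_zero ht))
    (hP.le_of_diagonal_zero (hLP ht) (hL.eq_zero ht) (hL'.eq_zero ht'))
  obtain ⟨⟨z, -, rfl⟩, -⟩ := hL
  obtain ⟨⟨z', -, rfl⟩, -⟩ := hL'
  rw [connectedComponentIn_eq ht, connectedComponentIn_eq ht']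

theorem IsGrowthRegion.mem_closure_of_eq_zero (hP : IsGrowthRegion f P) (hl : l ∈ P)
    (h0 : f l = 0) : l ∈ closure (P ∩ {l | 0 < f l}) := by
  have hcont : Continuous fun s : ℝ => (fun i => l i + s : Fin n → ℝ) := by fun_prop
  have htend : Tendsto (fun s : ℝ => (fun i => l i + s : Fin n → ℝ))
      (nhdsWithin 0 (Set.Ioi 0)) (nhds l) := by
    simpa using (hcont.tendsto 0).mono_left nhdsWithin_le_nhds
  refine mem_closure_of_tendsto htend ?_
  filter_upwards [htend.eventually_mem (hP.isOpen.mem_nhds hl), self_mem_nhdsWithin] with s hs hs0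
  exact ⟨hs, h0.symm.trans_lt (hP.lt_add l hl s hs0)⟩

theorem IsGrowthRegion.frontier_inter_pos (hP : IsGrowthRegion f P) (hf : Continuous f) :
    frontier (P ∩ {l | 0 < f l}) = P ∩ {l | f l = 0} := by
  rw [(hP.isOpen.inter (isOpen_lt continuous_const hf)).frontier_eq]
  ext l
  constructor
  · rintro ⟨hcl, hnot⟩
    have hnonneg : 0 ≤ f l :=
      closure_minimal (fun k hk => show 0 ≤ f k from le_of_lt hk.2)
        (isClosed_le continuous_const hf) hcl
    have hl : l ∈ P := hP.mem_of_mem_closure l (closure_mono Set.inter_subset_left hcl) hnonneg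
    exact ⟨hl, le_antisymm (not_lt.1 fun hpos => hnot ⟨hl, hpos⟩) hnonneg⟩
  · rintro ⟨hl, h0⟩
    exact ⟨hP.mem_closure_of_eq_zero hl h0, fun h => h.2.ne' h0⟩

theorem IsGrowthRegion.isConnectedComponentOf (hP : IsGrowthRegion f P)
    (hne : (P ∩ {l | 0 < f l}).Nonempty) (hconn : IsPreconnected (P ∩ {l | 0 < f l})) :
    IsConnectedComponentOf (P ∩ {l | 0 < f l}) {l | 0 < f l} := by
  obtain ⟨l, hl, hpos⟩ := hne
  refine ⟨l, hpos, subset_antisymm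
    (hconn.subset_connectedComponentIn ⟨hl, hpos⟩ Set.inter_subset_right)
    (Set.subset_inter (hP.subset_of_isPreconnected isPreconnected_connectedComponentIn ?_ ?_)
      (connectedComponentIn_subset _ _))⟩
  · exact fun k hk => (connectedComponentIn_subset {l | 0 < f l} l hk).le
  · exact ⟨l, mem_connectedComponentIn hpos, hl⟩

theorem IsGrowthRegion.hasConvexLevelSet [NeZero n] (hP : IsGrowthRegion f P) (hf : Continuous f)
    (hpair : ∀ i j, i ≠ j → ∀ l, ∃ A B C, PairForm f i j l A B C)
    (hmeet : ∀ L, IsLevelSetOf f L → (L ∩ P).Nonempty) (hzero : ∃ l ∈ P, f l = 0)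
    (hconv : Convex ℝ (P ∩ {l | 0 < f l})) : HasConvexLevelSet f := by
  have hsub (L) (hL : IsLevelSetOf f L) : L ⊆ P := hP.subset_of_isLevelSetOf hL (hmeet L hL)
  have huniq (L L') (hL : IsLevelSetOf f L) (hL' : IsLevelSetOf f L') : L = L' :=
    hP.eq_of_isLevelSetOf hf hpair hL hL' (hsub L hL) (hsub L' hL')
  obtain ⟨z, hz, hz0⟩ := hzero
  have hne : (P ∩ {l | 0 < f l}).Nonempty :=
    closure_nonempty_iff.1 ⟨z, hP.mem_closure_of_eq_zero hz hz0⟩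
  refine ⟨⟨_, hP.isLevelSetOf hz hz0, fun L hL => huniq _ _ hL (hP.isLevelSetOf hz hz0)⟩,
    fun L hL => ⟨P ∩ {l | 0 < f l}, hP.isConnectedComponentOf hne hconv.isPreconnected,
      ⟨0, Set.inter_subset_left.trans hP.subset_orthant⟩, ?_, hconv⟩⟩
  rw [hP.frontier_inter_pos hf]
  refine subset_antisymm (fun l hl => ?_) fun l hl => ⟨hsub L hL hl, hL.eq_zero hl⟩
  rw [huniq _ _ hL (hP.isLevelSetOf hl.1 hl.2)]
  exact mem_connectedComponentIn hl.2

theorem IsGrowthRegion.hasConvexLevelSet_invSigma [NeZero n] {c : Fin n → ℝ}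
    (hP : IsGrowthRegion (invSigma c) P)
    (hmeet : ∀ L, IsLevelSetOf (invSigma c) L → (L ∩ P).Nonempty) {r : ℝ}
    (hr : invSigma c (fun _ => r) < 0) (hdiag : ∀ t > r, (fun _ => t) ∈ P)
    (hconv : Convex ℝ (P ∩ {l | 0 < invSigma c l})) : HasConvexLevelSet (invSigma c) := by
  refine hP.hasConvexLevelSet (continuous_invSigma c) (fun i j => exists_pairForm_invSigma c)
    hmeet ?_ hconv
  have hcont : Continuous fun t => invSigma c fun _ => t :=
    (continuous_invSigma c).comp (continuous_pi fun _ => continuous_id)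
  obtain ⟨M, hM, hrM⟩ := ((tendsto_invSigma_diagonal c).eventually_ge_atTop 0).and
    (eventually_ge_atTop r) |>.exists
  obtain ⟨t, ht, ht0⟩ := intermediate_value_Icc hrM hcont.continuousOn ⟨hr.le, hM⟩
  have hrt : r < t := lt_of_le_of_ne ht.1 fun h => hr.ne (h ▸ ht0)
  exact ⟨_, hdiag t hrt, ht0⟩

end LevelSets

section Convexity

variable {E : Type*} [AddCommGroup E] [Module ℝ E] {s : Set E} {u v : E → ℝ}

theorem concaveOn_log_comp (hu : ConcaveOn ℝ s u) (hu0 : ∀ x ∈ s, 0 < u x) :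
    ConcaveOn ℝ s fun x => Real.log (u x) :=
  ⟨hu.1, fun x hx y hy _ _ ha hb hab =>
    (strictConcaveOn_log_Ioi.concaveOn.2 (hu0 x hx) (hu0 y hy) ha hb hab).trans
      (Real.log_le_log (convex_Ioi (0 : ℝ) (hu0 x hx) (hu0 y hy) ha hb hab) (hu.2 hx hy ha hb hab))⟩

theorem convexOn_inv_mul (hu : ConcaveOn ℝ s u) (hv : ConcaveOn ℝ s v)
    (hu0 : ∀ x ∈ s, 0 < u x) (hv0 : ∀ x ∈ s, 0 < v x) : ConvexOn ℝ s fun x => (u x * v x)⁻¹ := by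
  have hlog := ((concaveOn_log_comp hu hu0).add (concaveOn_log_comp hv hv0)).neg
  have hexp : ∀ x ∈ s, Real.exp (-(Real.log (u x) + Real.log (v x))) = (u x * v x)⁻¹ := by
    intro x hx
    rw [Real.exp_neg, Real.exp_add, Real.exp_log (hu0 x hx), Real.exp_log (hv0 x hx)]
  refine ConvexOn.congr ⟨hu.1, fun x hx y hy a b ha hb hab => ?_⟩ hexp
  exact (Real.exp_le_exp.2 (hlog.2 hx hy ha hb hab)).trans
    (convexOn_exp.2 trivial trivial ha hb hab)

-- Cauchy–Schwarz for the vectors `(√(a u₁), √(b u₂), √k)` and `(√(a v₁), √(b v₂), √k)`.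
theorem sq_add_sqrt_mul_le {a b u₁ v₁ u₂ v₂ k : ℝ} (ha : 0 ≤ a) (hb : 0 ≤ b) (hu₁ : 0 ≤ u₁)
    (hv₁ : 0 ≤ v₁) (hu₂ : 0 ≤ u₂) (hv₂ : 0 ≤ v₂) (hk : 0 ≤ k) :
    (a * √(u₁ * v₁) + b * √(u₂ * v₂) + k) ^ 2 ≤
      (a * u₁ + b * u₂ + k) * (a * v₁ + b * v₂ + k) := by
  have h1 := mul_nonneg (mul_nonneg ha hb) (sq_nonneg (√u₁ * √v₂ - √u₂ * √v₁))
  have h2 := mul_nonneg (mul_nonneg ha hk) (sq_nonneg (√u₁ - √v₁))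
  have h3 := mul_nonneg (mul_nonneg hb hk) (sq_nonneg (√u₂ - √v₂))
  calc (a * √(u₁ * v₁) + b * √(u₂ * v₂) + k) ^ 2
      = (a * (√u₁ * √v₁) + b * (√u₂ * √v₂) + k) ^ 2 := by
        rw [Real.sqrt_mul hu₁, Real.sqrt_mul hu₂]
    _ ≤ (a * √u₁ ^ 2 + b * √u₂ ^ 2 + k) * (a * √v₁ ^ 2 + b * √v₂ ^ 2 + k) := by linarith
    _ = (a * u₁ + b * u₂ + k) * (a * v₁ + b * v₂ + k) := by
        rw [Real.sq_sqrt hu₁, Real.sq_sqrt hu₂, Real.sq_sqrt hv₁, Real.sq_sqrt hv₂]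

-- It suffices to consider the vertices `z = w = c u + √((z - c u) (w - c u))` of the hyperbolas.
theorem convex_hyperbola_fibration {V : Set E} {c d : E → ℝ} (hc : ConvexOn ℝ V c)
    (hdiag : Convex ℝ {p : E × ℝ | p.1 ∈ V ∧ c p.1 < p.2 ∧ d p.1 < (p.2 - c p.1) ^ 2}) :
    Convex ℝ {p : E × ℝ × ℝ | p.1 ∈ V ∧ c p.1 < p.2.1 ∧ c p.1 < p.2.2 ∧
      d p.1 < (p.2.1 - c p.1) * (p.2.2 - c p.1)} := by
  have hvertex {u : E} {z w : ℝ} (hu : u ∈ V) (hz : c u < z) (hw : c u < w)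
      (hd : d u < (z - c u) * (w - c u)) : (u, c u + √((z - c u) * (w - c u))) ∈
        {p : E × ℝ | p.1 ∈ V ∧ c p.1 < p.2 ∧ d p.1 < (p.2 - c p.1) ^ 2} := by
    have hpos : 0 < (z - c u) * (w - c u) := mul_pos (sub_pos.2 hz) (sub_pos.2 hw)
    refine ⟨hu, lt_add_of_pos_right _ (Real.sqrt_pos.2 hpos), ?_⟩
    simpa [Real.sq_sqrt hpos.le] using hd
  rintro ⟨u₁, z₁, w₁⟩ ⟨hu₁, hz₁, hw₁, hd₁⟩ ⟨u₂, z₂, w₂⟩ ⟨hu₂, hz₂, hw₂, hd₂⟩ a b ha hb hab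
  obtain ⟨hu, -, hd⟩ := hdiag (hvertex hu₁ hz₁ hw₁ hd₁) (hvertex hu₂ hz₂ hw₂ hd₂) ha hb hab
  have hcu := hc.2 hu₁ hu₂ ha hb hab
  have hlt {x₁ x₂ : ℝ} (h₁ : c u₁ < x₁) (h₂ : c u₂ < x₂) : c (a • u₁ + b • u₂) < a * x₁ + b * x₂ :=
    (hc.convex_strict_epigraph (show (u₁, x₁) ∈ _ from ⟨hu₁, h₁⟩)
      (show (u₂, x₂) ∈ _ from ⟨hu₂, h₂⟩) ha hb hab).2
  refine ⟨hu, hlt hz₁ hz₂, hlt hw₁ hw₂, hd.trans_le ?_⟩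
  have hcs := sq_add_sqrt_mul_le ha hb (sub_pos.2 hz₁).le (sub_pos.2 hw₁).le (sub_pos.2 hz₂).le
    (sub_pos.2 hw₂).le (sub_nonneg.2 hcu)
  simp only [Prod.smul_mk, Prod.mk_add_mk, smul_eq_mul] at hcs ⊢
  calc (a * (c u₁ + √((z₁ - c u₁) * (w₁ - c u₁))) + b * (c u₂ + √((z₂ - c u₂) * (w₂ - c u₂))) -
          c (a • u₁ + b • u₂)) ^ 2
      = _ := by ring
    _ ≤ _ := hcs
    _ = _ := by ring

end Convexity

section Cubic

/-- The part of the plane above the upper branch of the hyperbola `x y = g ^ 2`. -/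
def hyperbolaRegion (g : ℝ) : Set (ℝ × ℝ) :=
  {p | 0 < p.1 ∧ 0 < p.2 ∧ g ^ 2 < p.1 * p.2}

/-- The function whose graph is the sheet `x y z = g ^ 2 (x + y + z) + c`,
`z = hyperbolaCentre g c (x, y)`, over `hyperbolaRegion g`. -/
noncomputable def hyperbolaCentre (g c : ℝ) (p : ℝ × ℝ) : ℝ :=
  (g ^ 2 * (p.1 + p.2) + c) / (p.1 * p.2 - g ^ 2)

/-- The point `(x, y, z)` lies above the sheet `x y z = g ^ 2 (x + y + z) + c` over
`hyperbolaRegion g`. -/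
def CubicPos (g c x y z : ℝ) : Prop :=
  (x, y) ∈ hyperbolaRegion g ∧ g ^ 2 * (x + y + z) + c < x * y * z

variable {g c x y z : ℝ}

theorem convex_hyperbolaRegion (g : ℝ) : Convex ℝ (hyperbolaRegion g) := by
  have hepi : hyperbolaRegion g =
      {p | p.1 ∈ Set.Ioi (0 : ℝ) ∧ g ^ 2 • p.1 ^ (-1 : ℤ) < p.2} := by
    ext p
    refine and_congr_right fun hx => ?_
    rw [smul_eq_mul, zpow_neg_one, ← div_eq_mul_inv, div_lt_iff₀ hx, mul_comm p.2]
    exact and_iff_right_of_imp fun h => pos_of_mul_pos_right ((sq_nonneg g).trans_lt h) hx.le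
  rw [hepi]
  exact ((convexOn_zpow (-1)).smul (sq_nonneg g)).convex_strict_epigraph

theorem two_mul_lt_add_of_mem_hyperbolaRegion (h : (x, y) ∈ hyperbolaRegion g) :
    2 * g < x + y := by
  obtain ⟨hx, hy, hxy⟩ := h
  exact lt_of_pow_lt_pow_left₀ 2 (add_pos hx hy).le (by linarith [sq_nonneg (x - y)])

theorem convexOn_sq_div : ConvexOn ℝ {p : ℝ × ℝ | 0 < p.2} fun p => p.1 ^ 2 / p.2 := by
  have hconv : Convex ℝ {p : ℝ × ℝ | 0 < p.2} :=
    (convex_Ioi (0 : ℝ)).linear_preimage (LinearMap.snd ℝ ℝ ℝ)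
  refine ⟨hconv, fun p (hp : 0 < p.2) q (hq : 0 < q.2) a b ha hb hab => ?_⟩
  have hpos : 0 < a * p.2 + b * q.2 := hconv (show p ∈ _ from hp) (show q ∈ _ from hq) ha hb hab
  change (a * p.1 + b * q.1) ^ 2 / (a * p.2 + b * q.2) ≤
    a * (p.1 ^ 2 / p.2) + b * (q.1 ^ 2 / q.2)
  have hdiff : (a * (p.1 ^ 2 / p.2) + b * (q.1 ^ 2 / q.2)) * (a * p.2 + b * q.2) -
      (a * p.1 + b * q.1) ^ 2 = a * b * (p.1 * q.2 - q.1 * p.2) ^ 2 / (p.2 * q.2) := by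
    field_simp
    ring
  have hnonneg : 0 ≤ a * b * (p.1 * q.2 - q.1 * p.2) ^ 2 / (p.2 * q.2) := by positivity
  rw [div_le_iff₀ hpos]
  linarith

theorem concaveOn_add_sub (g : ℝ) :
    ConcaveOn ℝ (hyperbolaRegion g) fun p => p.1 + p.2 - 2 * g :=
  ⟨convex_hyperbolaRegion g, fun p _ q _ a b _ _ hab => le_of_eq <| by
    simp only [Prod.fst_add, Prod.snd_add, Prod.smul_fst, Prod.smul_snd, smul_eq_mul]
    linear_combination (-2 * g) * hab⟩

-- With `α = x - g` and `β = y - g` the quotient is `g + α β / (α + β) = x - α ^ 2 / (α + β)`.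
theorem concaveOn_mul_sub_div_add_sub (g : ℝ) :
    ConcaveOn ℝ (hyperbolaRegion g) fun p => (p.1 * p.2 - g ^ 2) / (p.1 + p.2 - 2 * g) := by
  have hpos : ∀ p ∈ hyperbolaRegion g, 0 < p.1 + p.2 - 2 * g := fun p hp =>
    sub_pos.2 (two_mul_lt_add_of_mem_hyperbolaRegion hp)
  refine ConcaveOn.congr (f := fun p => p.1 - (p.1 - g) ^ 2 / (p.1 + p.2 - 2 * g))
    ⟨convex_hyperbolaRegion g, fun p hp q hq a b ha hb hab => ?_⟩ fun p hp => ?_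
  · have hsq := convexOn_sq_div.2 (x := (p.1 - g, p.1 + p.2 - 2 * g)) (hpos p hp)
      (y := (q.1 - g, q.1 + q.2 - 2 * g)) (hpos q hq) ha hb hab
    have hb' : b = 1 - a := by linarith
    subst hb'
    simp only [Prod.fst_add, Prod.snd_add, Prod.smul_fst, Prod.smul_snd, smul_eq_mul] at hsq ⊢
    ring_nf at hsq ⊢
    linarith
  · have hne := (hpos p hp).ne'
    dsimp only
    rw [eq_div_iff hne, sub_mul, div_mul_cancel₀ _ hne]
    ring

theorem hyperbolaCentre_lt_iff (h : (x, y) ∈ hyperbolaRegion g) :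
    hyperbolaCentre g c (x, y) < z ↔ g ^ 2 * (x + y + z) + c < x * y * z := by
  rw [hyperbolaCentre, div_lt_iff₀ (sub_pos.2 h.2.2)]
  constructor <;> intro <;> linarith

theorem cubicPos_iff_hyperbolaCentre_lt :
    CubicPos g c x y z ↔ (x, y) ∈ hyperbolaRegion g ∧ hyperbolaCentre g c (x, y) < z :=
  and_congr_right fun h => (hyperbolaCentre_lt_iff h).symm

-- `S = x + y - 2 g` and `K = (x y - g ^ 2) / S` are concave, and
-- `hyperbolaCentre g c (x, y) = g ^ 2 / K + (c + 2 g ^ 3) / (S K)`.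
theorem convexOn_hyperbolaCentre (hc : -2 * g ^ 3 ≤ c) :
    ConvexOn ℝ (hyperbolaRegion g) (hyperbolaCentre g c) := by
  have hS : ∀ p ∈ hyperbolaRegion g, 0 < p.1 + p.2 - 2 * g := fun p hp =>
    sub_pos.2 (two_mul_lt_add_of_mem_hyperbolaRegion hp)
  have hK : ∀ p ∈ hyperbolaRegion g, 0 < (p.1 * p.2 - g ^ 2) / (p.1 + p.2 - 2 * g) :=
    fun p hp => div_pos (sub_pos.2 hp.2.2) (hS p hp)
  have hconcave := concaveOn_mul_sub_div_add_sub g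
  refine (((convexOn_inv_mul (concaveOn_const 1 hconcave.1) hconcave (fun _ _ => one_pos) hK).smul
    (sq_nonneg g)).add ((convexOn_inv_mul (concaveOn_add_sub g) hconcave hS hK).smul
      (show 0 ≤ c + 2 * g ^ 3 by linarith))).congr fun p hp => ?_
  have hS' := (hS p hp).ne'
  have hD := (sub_pos.2 hp.2.2).ne'
  simp only [Pi.add_apply, smul_eq_mul, hyperbolaCentre, mul_div_cancel₀ _ hS', one_mul, inv_div]
  field_simp
  ring

theorem convex_cubicPos (hc : -2 * g ^ 3 ≤ c) :
    Convex ℝ {p : (ℝ × ℝ) × ℝ | CubicPos g c p.1.1 p.1.2 p.2} := by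
  convert (convexOn_hyperbolaCentre hc).convex_strict_epigraph using 1
  ext p
  exact cubicPos_iff_hyperbolaCentre_lt

theorem isOpen_setOf_mem_hyperbolaRegion {X : Type*} [TopologicalSpace X] {x y : X → ℝ}
    (hx : Continuous x) (hy : Continuous y) : IsOpen {p | (x p, y p) ∈ hyperbolaRegion g} :=
  (isOpen_lt continuous_const hx).inter
    ((isOpen_lt continuous_const hy).inter (isOpen_lt continuous_const (hx.mul hy)))

theorem isClosed_setOf_sq_le_mul {X : Type*} [TopologicalSpace X] {x y : X → ℝ}
    (hx : Continuous x) (hy : Continuous y) :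
    IsClosed {p | 0 ≤ x p ∧ 0 ≤ y p ∧ g ^ 2 ≤ x p * y p} :=
  (isClosed_le continuous_const hx).inter
    ((isClosed_le continuous_const hy).inter (isClosed_le continuous_const (hx.mul hy)))

theorem isOpen_setOf_cubicPos {X : Type*} [TopologicalSpace X] {x y z : X → ℝ}
    (hx : Continuous x) (hy : Continuous y) (hz : Continuous z) :
    IsOpen {p | CubicPos g c (x p) (y p) (z p)} :=
  (isOpen_setOf_mem_hyperbolaRegion hx hy).inter <|
    isOpen_lt ((continuous_const.mul ((hx.add hy).add hz)).add continuous_const)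
      ((hx.mul hy).mul hz)

theorem swap_mem_hyperbolaRegion (h : (x, y) ∈ hyperbolaRegion g) :
    (y, x) ∈ hyperbolaRegion g :=
  ⟨h.2.1, h.1, h.2.2.trans_eq (mul_comm x y)⟩

theorem mem_hyperbolaRegion_of_le (hx : 0 ≤ x) (hy : 0 ≤ y) (hxy : g ^ 2 ≤ x * y)
    (h : g ^ 2 * (x + y + z) - 2 * g ^ 3 < x * y * z) : (x, y) ∈ hyperbolaRegion g := by
  have hadd : 2 * g ≤ x + y :=
    le_of_sq_le_sq (by linarith [sq_nonneg (x - y)]) (add_nonneg hx hy)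
  have hlt : g ^ 2 < x * y := by
    refine lt_of_le_of_ne hxy fun heq => ?_
    rw [← heq] at h
    linarith [mul_nonneg (sq_nonneg g) (sub_nonneg.2 hadd)]
  have hpos : 0 < x * y := (sq_nonneg g).trans_lt hlt
  exact ⟨pos_of_mul_pos_left hpos hy, pos_of_mul_pos_right hpos hx, hlt⟩

theorem mem_hyperbolaRegion_right (h : (x, y) ∈ hyperbolaRegion g)
    (hz : g ^ 2 * (x + y + z) - 2 * g ^ 3 < x * y * z) : (x, z) ∈ hyperbolaRegion g := by
  obtain ⟨hx, -, hxy⟩ := h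
  have hprod : (x * z - g ^ 2) * (x * y - g ^ 2) =
      x * (x * y * z - (g ^ 2 * (x + y + z) - 2 * g ^ 3)) + g ^ 2 * (x - g) ^ 2 := by ring
  have hxz : g ^ 2 < x * z := by
    refine sub_pos.1 (pos_of_mul_pos_left (hprod ▸ ?_) (sub_pos.2 hxy).le)
    have := mul_pos hx (sub_pos.2 hz)
    positivity
  exact ⟨hx, pos_of_mul_pos_right ((sq_nonneg g).trans_lt hxz) hx.le, hxz⟩

theorem CubicPos.swap (h : CubicPos g c x y z) : CubicPos g c y x z :=
  ⟨swap_mem_hyperbolaRegion h.1, by linarith [h.2]⟩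

theorem CubicPos.mem_right (h : CubicPos g c x y z) (hc : -2 * g ^ 3 ≤ c) :
    (x, z) ∈ hyperbolaRegion g :=
  mem_hyperbolaRegion_right h.1 (by linarith [h.2])

theorem CubicPos.swap_right (h : CubicPos g c x y z) (hc : -2 * g ^ 3 ≤ c) :
    CubicPos g c x z y :=
  ⟨h.mem_right hc, by linarith [h.2]⟩

theorem CubicPos.mono_right (h : CubicPos g c x y z) {z' : ℝ} (hz : z ≤ z') :
    CubicPos g c x y z' :=
  ⟨h.1, by linarith [h.2, mul_nonneg (sub_pos.2 h.1.2.2).le (sub_nonneg.2 hz)]⟩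

theorem CubicPos.rotate (h : CubicPos g c x y z) (hc : -2 * g ^ 3 ≤ c) : CubicPos g c z x y :=
  (h.swap_right hc).swap

theorem CubicPos.mono (h : CubicPos g c x y z) (hc : -2 * g ^ 3 ≤ c) {x' y' z' : ℝ}
    (hx : x ≤ x') (hy : y ≤ y') (hz : z ≤ z') : CubicPos g c x' y' z' :=
  ((((h.mono_right hz).rotate hc).mono_right hy).rotate hc).mono_right hx |>.rotate hc

end Cubic

section LowDegree

theorem invSigma_two (c₀ : ℝ) (l : Fin 2 → ℝ) : invSigma ![c₀, 0] l = l 0 * l 1 - c₀ := by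
  simp [invSigma, sigmaSymm, MvPolynomial.esymm, Fin.sum_univ_succ, Fin.prod_univ_succ]

theorem pairForm_two (c₀ : ℝ) (l : Fin 2 → ℝ) :
    PairForm (invSigma ![c₀, 0]) 0 1 l 1 0 (-c₀) := by
  intro x y
  simp only [invSigma_two, ne_eq, Fin.reduceEq, not_false_eq_true, Function.update_of_ne,
    Function.update_self]
  ring

theorem isGrowthRegion_two {c₀ : ℝ} (hc₀ : 0 < c₀) :
    IsGrowthRegion (invSigma ![c₀, 0]) {l | 0 < l 0 ∧ 0 < l 1} where
  isOpen := (isOpen_lt continuous_const (continuous_apply 0)).inter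
    (isOpen_lt continuous_const (continuous_apply 1))
  mem_of_mem_closure l hl h0 := by
    have hclosed : IsClosed {l : Fin 2 → ℝ | 0 ≤ l 0 ∧ 0 ≤ l 1} :=
      (isClosed_le continuous_const (continuous_apply 0)).inter
        (isClosed_le continuous_const (continuous_apply 1))
    have hl' := hclosed.closure_subset_iff.2 (fun k hk => ⟨hk.1.le, hk.2.le⟩) hl
    rw [invSigma_two] at h0
    have hpos : 0 < l 0 * l 1 := by linarith
    exact ⟨pos_of_mul_pos_left hpos hl'.2, pos_of_mul_pos_right hpos hl'.1⟩
  subset_orthant l hl := Fin.forall_fin_two.2 hl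
  lt_add l hl s hs := by
    simp only [invSigma_two]
    linarith [mul_pos hl.1 hs, mul_pos hl.2 hs, mul_pos hs hs]

theorem hasConvexLevelSet_two {c₀ : ℝ} (hc₀ : 0 < c₀) :
    HasConvexLevelSet (invSigma ![c₀, 0]) := by
  refine (isGrowthRegion_two hc₀).hasConvexLevelSet_invSigma (r := 0) ?_ ?_ ?_ ?_
  · intro L hL
    obtain ⟨l, hl⟩ := hL.nonempty
    exact ⟨l, hl, by simpa using hL.upper_branch (by decide) hl (pairForm_two c₀ l),
      by simpa using hL.upper_branch (by decide) hl ((pairForm_two c₀ l).swap (by decide))⟩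
  · simpa [invSigma_two] using hc₀
  · exact fun t ht => ⟨ht, ht⟩
  · have hregion : {l : Fin 2 → ℝ | 0 < l 0 ∧ 0 < l 1} ∩ {l | 0 < invSigma ![c₀, 0] l} =
        (fun l => (l 0, l 1)) ⁻¹' hyperbolaRegion √c₀ := by
      ext l
      simp [hyperbolaRegion, invSigma_two, Real.sq_sqrt hc₀.le, and_assoc]
    rw [hregion]
    exact (convex_hyperbolaRegion _).is_linear_preimage ⟨fun _ _ => rfl, fun _ _ => rfl⟩

theorem invSigma_three (c₀ c₁ : ℝ) (l : Fin 3 → ℝ) :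
    invSigma ![c₀, c₁, 0] l = l 0 * l 1 * l 2 - c₁ * (l 0 + l 1 + l 2) - c₀ := by
  simp [invSigma, sigmaSymm, MvPolynomial.esymm, Fin.sum_univ_succ, Fin.prod_univ_succ,
    Finset.powersetCard_one]
  ring

theorem pairForm_three_zero_one (c₀ c₁ : ℝ) (l : Fin 3 → ℝ) :
    PairForm (invSigma ![c₀, c₁, 0]) 0 1 l (l 2) (-c₁) (-c₁ * l 2 - c₀) := by
  intro x y
  simp only [invSigma_three, ne_eq, Fin.reduceEq, not_false_eq_true, Function.update_of_ne,
    Function.update_self]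
  ring

theorem pairForm_three_one_two (c₀ c₁ : ℝ) (l : Fin 3 → ℝ) :
    PairForm (invSigma ![c₀, c₁, 0]) 1 2 l (l 0) (-c₁) (-c₁ * l 0 - c₀) := by
  intro x y
  simp only [invSigma_three, ne_eq, Fin.reduceEq, not_false_eq_true, Function.update_of_ne,
    Function.update_self]
  ring

/-- The region of `ℝ³` in which the first and second partial derivatives of
`l₁ l₂ l₃ - g ^ 2 (l₁ + l₂ + l₃) - c₀` are positive. -/
def cubicRegion (g : ℝ) : Set (Fin 3 → ℝ) :=
  {l | (l 0, l 1) ∈ hyperbolaRegion g ∧ (l 0, l 2) ∈ hyperbolaRegion g ∧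
    (l 1, l 2) ∈ hyperbolaRegion g}

variable {g c₀ : ℝ}

theorem isGrowthRegion_cubicRegion (hc₀ : -2 * g ^ 3 < c₀) :
    IsGrowthRegion (invSigma ![c₀, g ^ 2, 0]) (cubicRegion g) where
  isOpen := (isOpen_setOf_mem_hyperbolaRegion (by fun_prop) (by fun_prop)).inter
    ((isOpen_setOf_mem_hyperbolaRegion (by fun_prop) (by fun_prop)).inter
      (isOpen_setOf_mem_hyperbolaRegion (by fun_prop) (by fun_prop)))
  mem_of_mem_closure l hl h0 := by
    have hle (i j : Fin 3) (hij : ∀ l ∈ cubicRegion g, (l i, l j) ∈ hyperbolaRegion g) :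
        0 ≤ l i ∧ 0 ≤ l j ∧ g ^ 2 ≤ l i * l j :=
      (isClosed_setOf_sq_le_mul (continuous_apply i) (continuous_apply j)).closure_subset_iff.2
        (fun k hk => ⟨(hij k hk).1.le, (hij k hk).2.1.le, (hij k hk).2.2.le⟩) hl
    obtain ⟨hx, hy, hxy⟩ := hle 0 1 fun _ hk => hk.1
    obtain ⟨-, hz, hxz⟩ := hle 0 2 fun _ hk => hk.2.1
    obtain ⟨-, -, hyz⟩ := hle 1 2 fun _ hk => hk.2.2
    rw [invSigma_three] at h0
    exact ⟨mem_hyperbolaRegion_of_le hx hy hxy (z := l 2) (by linarith),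
      mem_hyperbolaRegion_of_le hx hz hxz (z := l 1) (by linarith),
      mem_hyperbolaRegion_of_le hy hz hyz (z := l 0) (by linarith)⟩
  subset_orthant l hl := by
    intro i
    fin_cases i
    exacts [hl.1.1, hl.1.2.1, hl.2.1.2.1]
  lt_add l hl s hs := by
    obtain ⟨⟨hx, hy, hxy⟩, ⟨-, hz, hxz⟩, ⟨-, -, hyz⟩⟩ := hl
    have hdiff : invSigma ![c₀, g ^ 2, 0] (fun i => l i + s) - invSigma ![c₀, g ^ 2, 0] l =
        s * ((l 0 * l 1 - g ^ 2) + (l 0 * l 2 - g ^ 2) + (l 1 * l 2 - g ^ 2)) +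
          s ^ 2 * (l 0 + l 1 + l 2) + s ^ 3 := by
      simp only [invSigma_three]
      ring
    have hsum := add_pos (add_pos (sub_pos.2 hxy) (sub_pos.2 hxz)) (sub_pos.2 hyz)
    have hrest : 0 < s ^ 2 * (l 0 + l 1 + l 2) + s ^ 3 := by positivity
    linarith [mul_pos hs hsum]

theorem IsLevelSetOf.inter_cubicRegion_nonempty (hc₀ : -2 * g ^ 3 < c₀) {L : Set (Fin 3 → ℝ)}
    (hL : IsLevelSetOf (invSigma ![c₀, g ^ 2, 0]) L) : (L ∩ cubicRegion g).Nonempty := by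
  obtain ⟨z, hz⟩ := hL.nonempty
  obtain ⟨x, y, hx, hl⟩ :=
    hL.exists_update_mem_of_lt (by decide) hz (pairForm_three_zero_one c₀ (g ^ 2) z) 0
  generalize hl_def : Function.update (Function.update z 0 x) 1 y = l at hl
  have h0 : 0 < l 0 := by simpa [← hl_def] using hx
  have h1 := hL.leading_mul_pos (by decide) hl (pairForm_three_one_two c₀ (g ^ 2) l)
  have h2 := hL.leading_mul_pos (by decide) hl
    ((pairForm_three_one_two c₀ (g ^ 2) l).swap (by decide))
  have hmem {t : ℝ} (ht : 0 < l 0 * (l 0 * t + -g ^ 2)) : (l 0, t) ∈ hyperbolaRegion g := by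
    have hlt : g ^ 2 < l 0 * t := by linarith [pos_of_mul_pos_right ht h0.le]
    exact ⟨h0, pos_of_mul_pos_right ((sq_nonneg g).trans_lt hlt) h0.le, hlt⟩
  have hzero := hL.eq_zero hl
  rw [invSigma_three] at hzero
  exact ⟨l, hl, hmem h1, hmem h2,
    mem_hyperbolaRegion_right (swap_mem_hyperbolaRegion (hmem h1)) (by linarith)⟩

theorem cubicRegion_inter_pos (hc₀ : -2 * g ^ 3 ≤ c₀) :
    cubicRegion g ∩ {l | 0 < invSigma ![c₀, g ^ 2, 0] l} =
      {l | CubicPos g c₀ (l 0) (l 1) (l 2)} := by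
  ext l
  have hpos : 0 < invSigma ![c₀, g ^ 2, 0] l ↔
      g ^ 2 * (l 0 + l 1 + l 2) + c₀ < l 0 * l 1 * l 2 := by
    rw [invSigma_three]
    constructor <;> intro <;> linarith
  exact ⟨fun h => ⟨h.1.1, hpos.1 h.2⟩,
    fun h => ⟨⟨h.1, h.mem_right hc₀, h.swap.mem_right hc₀⟩, hpos.2 h.2⟩⟩

theorem hasConvexLevelSet_three (hg : 0 ≤ g) (hc₀ : -2 * g ^ 3 < c₀) :
    HasConvexLevelSet (invSigma ![c₀, g ^ 2, 0]) := by
  refine (isGrowthRegion_cubicRegion hc₀).hasConvexLevelSet_invSigma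
    (fun L hL => hL.inter_cubicRegion_nonempty hc₀) (r := g) ?_ (fun t ht => ?_) ?_
  · rw [invSigma_three]
    linarith
  · have hmem : (t, t) ∈ hyperbolaRegion g :=
      ⟨hg.trans_lt ht, hg.trans_lt ht, by nlinarith⟩
    exact ⟨hmem, hmem, hmem⟩
  · rw [cubicRegion_inter_pos hc₀.le]
    exact (convex_cubicPos hc₀.le).is_linear_preimage (f := fun l : Fin 3 → ℝ => ((l 0, l 1), l 2))
      ⟨fun _ _ => rfl, fun _ _ => rfl⟩

end LowDegree

section Quartic

theorem exists_maclaurin_bound {a b c : ℝ} (he₁ : 0 ≤ a + b + c)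
    (he₂ : 0 ≤ a * b + a * c + b * c) :
    ∃ v, 0 ≤ v ∧ a * b + a * c + b * c = 3 * v ^ 2 ∧ 3 * v ≤ a + b + c ∧ a * b * c ≤ v ^ 3 := by
  obtain ⟨v, hv, hv₂⟩ : ∃ v, 0 ≤ v ∧ a * b + a * c + b * c = 3 * v ^ 2 :=
    ⟨√((a * b + a * c + b * c) / 3), Real.sqrt_nonneg _, by rw [Real.sq_sqrt] <;> linarith⟩
  have hv₁ : 3 * v ≤ a + b + c := by
    refine le_of_sq_le_sq ?_ he₁
    linarith [sq_nonneg (a - b), sq_nonneg (a - c), sq_nonneg (b - c)]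
  refine ⟨v, hv, hv₂, hv₁, not_lt.1 fun hlt => ?_⟩
  have hprod : (a + b + c) * (a * b * c) ≤ 3 * v ^ 4 := by
    have hsq : (a * b + a * c + b * c) ^ 2 = 9 * v ^ 4 := by rw [hv₂]; ring
    linarith [sq_nonneg (a * b - a * c), sq_nonneg (a * b - b * c), sq_nonneg (a * c - b * c)]
  have hv_zero : v = 0 := by
    by_contra hne
    have h := mul_lt_mul_of_pos_left hlt (mul_pos three_pos (lt_of_le_of_ne hv (Ne.symm hne)))
    linarith [mul_le_mul_of_nonneg_right hv₁ ((pow_nonneg hv 3).trans hlt.le)]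
  subst hv_zero
  have habc : 0 < a * b * c := by simpa using hlt
  have he₁' : a + b + c = 0 :=
    le_antisymm (nonpos_of_mul_nonpos_left (by simpa using hprod) habc) he₁
  have hsq : a ^ 2 + b ^ 2 + c ^ 2 = 0 := by linear_combination (a + b + c) * he₁' - 2 * hv₂
  have ha : a = 0 := pow_eq_zero_iff two_ne_zero |>.1
    (le_antisymm (by linarith [sq_nonneg b, sq_nonneg c]) (sq_nonneg a))
  simp [ha] at habc

/-- The coefficients of the quartic `xyzw - g² σ₂ - c₁ σ₁ - c₀` satisfy the hypotheses of the
proposition, with `r` the largest critical point `t` of its restriction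
`t⁴ - 6 g² t² - 4 c₁ t - c₀` to the diagonal; by `coeff_eq`, that restriction takes the value
`-3 g² r² - 3 c₁ r - c₀` at `r`. -/
structure IsStableQuartic (g r c₁ c₀ : ℝ) : Prop where
  nonneg : 0 ≤ g
  le : g ≤ r
  coeff_eq : c₁ = r ^ 3 - 3 * g ^ 2 * r
  lt : -3 * g ^ 2 * r ^ 2 - 3 * c₁ * r < c₀

/-- The polynomial `xyzw - g² σ₂ - c₁ σ₁ - c₀`. -/
def quartic (g c₁ c₀ x y z w : ℝ) : ℝ :=
  x * y * z * w - g ^ 2 * (x * y + x * z + x * w + y * z + y * w + z * w) -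
    c₁ * (x + y + z + w) - c₀

variable {g r c₁ c₀ x y z w : ℝ}

theorem IsStableQuartic.neg_two_mul_cube_le (h : IsStableQuartic g r c₁ c₀) : -2 * g ^ 3 ≤ c₁ := by
  have := mul_nonneg (sq_nonneg (r - g)) (show 0 ≤ r + 2 * g by linarith [h.nonneg, h.le])
  rw [h.coeff_eq]
  linarith

theorem pairwise_mul_sub_nonneg (hxy : (x, y) ∈ hyperbolaRegion g)
    (hz : g ^ 2 * (x + y + z) - 2 * g ^ 3 ≤ x * y * z) :
    0 ≤ (x - g) * (y - g) + (x - g) * (z - g) + (y - g) * (z - g) := by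
  have hprod : ((x - g) * (y - g) + (x - g) * (z - g) + (y - g) * (z - g)) * (x * y - g ^ 2) =
      ((x - g) * (y - g)) ^ 2 +
        (x + y - 2 * g) * (x * y * z - (g ^ 2 * (x + y + z) - 2 * g ^ 3)) := by ring
  refine nonneg_of_mul_nonneg_left (hprod ▸ add_nonneg (sq_nonneg _) ?_) (sub_pos.2 hxy.2.2)
  exact mul_nonneg (sub_pos.2 (two_mul_lt_add_of_mem_hyperbolaRegion hxy)).le (sub_nonneg.2 hz)

theorem add_sub_nonneg_of_mem_hyperbolaRegion (hxy : (x, y) ∈ hyperbolaRegion g)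
    (hz : g ^ 2 * (x + y + z) - 2 * g ^ 3 ≤ x * y * z) :
    0 ≤ (x - g) + (y - g) + (z - g) := by
  have hprod : ((x - g) + (y - g) + (z - g)) * (x + y - 2 * g) =
      ((x - g) * (y - g) + (x - g) * (z - g) + (y - g) * (z - g)) +
        ((x - g) ^ 2 + (y - g) ^ 2 + (x + y - 2 * g) ^ 2) / 2 := by ring
  refine nonneg_of_mul_nonneg_left (hprod ▸ add_nonneg (pairwise_mul_sub_nonneg hxy hz) ?_)
    (sub_pos.2 (two_mul_lt_add_of_mem_hyperbolaRegion hxy))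
  positivity

-- Among the points on or above the cubic sheet, the left side is smallest at `(r, r, r)`.
theorem IsStableQuartic.le_of_cubic_nonneg (h : IsStableQuartic g r c₁ c₀)
    (hxy : (x, y) ∈ hyperbolaRegion g) (hz : g ^ 2 * (x + y + z) + c₁ ≤ x * y * z) :
    3 * g ^ 2 * r ^ 2 + 3 * c₁ * r ≤ g ^ 2 * (x * y + x * z + y * z) + c₁ * (x + y + z) := by
  have hz' : g ^ 2 * (x + y + z) - 2 * g ^ 3 ≤ x * y * z := by linarith [h.neg_two_mul_cube_le]
  obtain ⟨v, hv, hv₂, hv₁, hv₃⟩ := exists_maclaurin_bound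
    (add_sub_nonneg_of_mem_hyperbolaRegion hxy hz') (pairwise_mul_sub_nonneg hxy hz')
  have hg := h.nonneg
  have hρ := sub_nonneg.2 h.le
  have hc := h.coeff_eq
  have hvρ : r - g ≤ v := by
    by_contra! hlt
    have h3 := pow_lt_pow_left₀ hlt hv three_ne_zero
    have h2 := mul_le_mul_of_nonneg_left (pow_le_pow_left₀ hv hlt.le 2) hg
    have hcubic : (r - g) ^ 3 + 3 * g * (r - g) ^ 2 ≤ (x - g) * (y - g) * (z - g) +
        g * ((x - g) * (y - g) + (x - g) * (z - g) + (y - g) * (z - g)) := by linarith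
    rw [hv₂] at hcubic
    linarith
  have hκ : 0 ≤ (r - g) ^ 3 + 3 * g * (r - g) ^ 2 := by positivity
  have h2 := mul_le_mul_of_nonneg_left (pow_le_pow_left₀ hρ hvρ 2)
    (mul_nonneg three_pos.le (sq_nonneg g))
  rw [mul_comm 3, mul_assoc _ _ (v ^ 2), ← hv₂] at h2
  have h1 := mul_le_mul_of_nonneg_left (show 3 * (r - g) ≤ x - g + (y - g) + (z - g) by linarith) hκ
  subst hc
  linarith

theorem IsStableQuartic.pos_of_cubic_nonneg (h : IsStableQuartic g r c₁ c₀)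
    (hxy : (x, y) ∈ hyperbolaRegion g) (hz : g ^ 2 * (x + y + z) + c₁ ≤ x * y * z) :
    0 < g ^ 2 * (x * y + x * z + y * z) + c₁ * (x + y + z) + c₀ := by
  linarith [h.le_of_cubic_nonneg hxy hz, h.lt]

theorem quartic_eq_mul_sub : quartic g c₁ c₀ x y z w =
    w * (x * y * z - (g ^ 2 * (x + y + z) + c₁)) -
      (g ^ 2 * (x * y + x * z + y * z) + c₁ * (x + y + z) + c₀) := by
  rw [quartic]
  ring

theorem CubicPos.strictMono_quartic (h : CubicPos g c₁ x y z) :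
    StrictMono (quartic g c₁ c₀ x y z) := fun w w' hw => by
  rw [quartic_eq_mul_sub, quartic_eq_mul_sub]
  linarith [mul_lt_mul_of_pos_right hw (sub_pos.2 h.2)]

-- Otherwise raise `w` to the point `w'` with `(x, z, w')` on the cubic sheet.
theorem CubicPos.of_quartic_nonneg (hxyz : CubicPos g c₁ x y z) (h : IsStableQuartic g r c₁ c₀)
    (hf : 0 ≤ quartic g c₁ c₀ x y z w) : CubicPos g c₁ x z w := by
  have hxz := hxyz.mem_right h.neg_two_mul_cube_le
  refine cubicPos_iff_hyperbolaCentre_lt.2 ⟨hxz, not_le.1 fun hle => ?_⟩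
  set w' := hyperbolaCentre g c₁ (x, z)
  have hw' : g ^ 2 * (x + z + w') + c₁ = x * z * w' := by
    have hmul : w' * (x * z - g ^ 2) = g ^ 2 * (x + z) + c₁ :=
      div_mul_cancel₀ _ (sub_pos.2 hxz.2.2).ne'
    linarith
  have hpos := h.pos_of_cubic_nonneg hxz hw'.le
  have hf' := hf.trans (hxyz.strictMono_quartic.monotone hle)
  have hswap : quartic g c₁ c₀ x y z w' = y * (x * z * w' - (g ^ 2 * (x + z + w') + c₁)) -
      (g ^ 2 * (x * z + x * w' + z * w') + c₁ * (x + z + w') + c₀) := by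
    rw [quartic]
    ring
  rw [hswap, hw', sub_self, mul_zero] at hf'
  linarith

theorem quartic_swap₁₂ : quartic g c₁ c₀ x y z w = quartic g c₁ c₀ y x z w := by
  rw [quartic, quartic]
  ring

theorem quartic_swap₂₃ : quartic g c₁ c₀ x y z w = quartic g c₁ c₀ x z y w := by
  rw [quartic, quartic]
  ring

theorem quartic_rotate : quartic g c₁ c₀ x y z w = quartic g c₁ c₀ y z w x := by
  rw [quartic, quartic]
  ring

theorem invSigma_four (l : Fin 4 → ℝ) :
    invSigma ![c₀, c₁, g ^ 2, 0] l = quartic g c₁ c₀ (l 0) (l 1) (l 2) (l 3) := by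
  have hσ : ∑ t ∈ Finset.powersetCard 2 (Finset.univ : Finset (Fin 4)), ∏ i ∈ t, l i =
      l 0 * l 1 + l 0 * l 2 + l 0 * l 3 + l 1 * l 2 + l 1 * l 3 + l 2 * l 3 := by
    have hpairs : Finset.powersetCard 2 (Finset.univ : Finset (Fin 4)) =
        {{0, 1}, {0, 2}, {0, 3}, {1, 2}, {1, 3}, {2, 3}} := by decide
    rw [hpairs]
    repeat rw [Finset.sum_insert (by decide)]
    simp only [Finset.sum_singleton]
    repeat rw [Finset.prod_pair (by decide)]
    ring
  simp [invSigma, quartic, sigmaSymm, MvPolynomial.esymm, Fin.sum_univ_succ, Fin.prod_univ_succ,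
    Finset.powersetCard_one, hσ]
  ring

/-- The region of `ℝ⁴` in which the first, second and third partial derivatives of
`l₁ l₂ l₃ l₄ - g ^ 2 σ₂(l) - c₁ σ₁(l) - c₀` are positive. -/
def quarticRegion (g c₁ : ℝ) : Set (Fin 4 → ℝ) :=
  {l | CubicPos g c₁ (l 0) (l 1) (l 2) ∧ CubicPos g c₁ (l 0) (l 1) (l 3) ∧
    CubicPos g c₁ (l 0) (l 2) (l 3) ∧ CubicPos g c₁ (l 1) (l 2) (l 3)}

theorem CubicPos.mem_quarticRegion {l : Fin 4 → ℝ} (hl : CubicPos g c₁ (l 0) (l 1) (l 2))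
    (h : IsStableQuartic g r c₁ c₀) (hf : 0 ≤ invSigma ![c₀, c₁, g ^ 2, 0] l) :
    l ∈ quarticRegion g c₁ := by
  rw [invSigma_four] at hf
  have hl' := hl.swap_right h.neg_two_mul_cube_le
  exact ⟨hl, hl'.of_quartic_nonneg h (quartic_swap₂₃ ▸ hf), hl.of_quartic_nonneg h hf,
    hl.swap.of_quartic_nonneg h (quartic_swap₁₂ ▸ hf)⟩

theorem IsStableQuartic.cubicPos_of_mem_closure (h : IsStableQuartic g r c₁ c₀) {i j k : Fin 4}
    {P : Set (Fin 4 → ℝ)} (hP : ∀ l ∈ P, CubicPos g c₁ (l i) (l j) (l k)) {l : Fin 4 → ℝ}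
    (hl : l ∈ closure P) (hf : 0 ≤ quartic g c₁ c₀ (l i) (l j) (l k) w) :
    CubicPos g c₁ (l i) (l j) (l k) := by
  have hc := h.neg_two_mul_cube_le
  obtain ⟨hx, hy, hxy⟩ : 0 ≤ l i ∧ 0 ≤ l j ∧ g ^ 2 ≤ l i * l j :=
    (isClosed_setOf_sq_le_mul (continuous_apply i) (continuous_apply j)).closure_subset_iff.2
      (fun k hk => ⟨(hP k hk).1.1.le, (hP k hk).1.2.1.le, (hP k hk).1.2.2.le⟩) hl
  have hD : g ^ 2 * (l i + l j + l k) + c₁ ≤ l i * l j * l k :=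
    (isClosed_le (f := fun l : Fin 4 → ℝ => g ^ 2 * (l i + l j + l k) + c₁) (by fun_prop)
      (by fun_prop)).closure_subset_iff.2 (fun k hk => (hP k hk).2.le) hl
  have hE : 3 * g ^ 2 * r ^ 2 + 3 * c₁ * r ≤
      g ^ 2 * (l i * l j + l i * l k + l j * l k) + c₁ * (l i + l j + l k) :=
    (isClosed_le (g := fun l : Fin 4 → ℝ => g ^ 2 * (l i * l j + l i * l k + l j * l k) +
      c₁ * (l i + l j + l k)) continuous_const (by fun_prop)).closure_subset_iff.2
      (fun k hk => h.le_of_cubic_nonneg (hP k hk).1 (hP k hk).2.le) hl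
  have hD' : g ^ 2 * (l i + l j + l k) + c₁ < l i * l j * l k := by
    refine lt_of_le_of_ne hD fun heq => ?_
    rw [quartic_eq_mul_sub, heq, sub_self, mul_zero] at hf
    linarith [h.lt]
  exact ⟨mem_hyperbolaRegion_of_le hx hy hxy (z := l k) (by linarith), hD'⟩

theorem quartic_le_quartic (hc : -2 * g ^ 3 ≤ c₁) (hxyz : CubicPos g c₁ x y z)
    (hxyw : CubicPos g c₁ x y w) (hxzw : CubicPos g c₁ x z w) (hyzw : CubicPos g c₁ y z w)
    {x' y' z' w' : ℝ} (hx : x ≤ x') (hy : y ≤ y') (hz : z ≤ z') (hw : w ≤ w') :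
    quartic g c₁ c₀ x y z w ≤ quartic g c₁ c₀ x' y' z' w' :=
  calc quartic g c₁ c₀ x y z w
      ≤ quartic g c₁ c₀ x y z w' := hxyz.strictMono_quartic.monotone hw
    _ = quartic g c₁ c₀ w' x y z := quartic_rotate.symm
    _ ≤ quartic g c₁ c₀ w' x y z' :=
        ((hxyw.rotate hc).mono hc hw le_rfl le_rfl).strictMono_quartic.monotone hz
    _ = quartic g c₁ c₀ z' w' x y := quartic_rotate.symm
    _ ≤ quartic g c₁ c₀ z' w' x y' :=
        (((hxzw.rotate hc).rotate hc).mono hc hz hw le_rfl).strictMono_quartic.monotone hy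
    _ = quartic g c₁ c₀ y' z' w' x := quartic_rotate.symm
    _ ≤ quartic g c₁ c₀ y' z' w' x' := (hyzw.mono hc hy hz hw).strictMono_quartic.monotone hx
    _ = quartic g c₁ c₀ x' y' z' w' := quartic_rotate.symm

theorem isOpen_quarticRegion : IsOpen (quarticRegion g c₁) :=
  have hopen (i j k : Fin 4) : IsOpen {l : Fin 4 → ℝ | CubicPos g c₁ (l i) (l j) (l k)} :=
    isOpen_setOf_cubicPos (continuous_apply i) (continuous_apply j) (continuous_apply k)
  (hopen 0 1 2).inter ((hopen 0 1 3).inter ((hopen 0 2 3).inter (hopen 1 2 3)))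

theorem IsStableQuartic.isGrowthRegion_quarticRegion (h : IsStableQuartic g r c₁ c₀) :
    IsGrowthRegion (invSigma ![c₀, c₁, g ^ 2, 0]) (quarticRegion g c₁) where
  isOpen := isOpen_quarticRegion
  mem_of_mem_closure l hl hf :=
    (h.cubicPos_of_mem_closure (fun _ hk => hk.1) hl (invSigma_four l ▸ hf)).mem_quarticRegion h hf
  subset_orthant l hl i := by
    fin_cases i
    exacts [hl.1.1.1, hl.1.1.2.1, hl.2.2.1.1.2.1, (hl.2.1.mem_right h.neg_two_mul_cube_le).2.1]
  lt_add l hl s hs := by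
    obtain ⟨h012, h013, h023, h123⟩ := hl
    have hc := h.neg_two_mul_cube_le
    have hle (i : Fin 4) : l i ≤ l i + s := le_add_of_nonneg_right hs.le
    simp only [invSigma_four]
    exact (quartic_le_quartic hc h012 h013 h023 h123 (hle 0) (hle 1) (hle 2) le_rfl).trans_lt
      ((h012.mono hc (hle 0) (hle 1) (hle 2)).strictMono_quartic (lt_add_of_pos_right _ hs))

theorem pairForm_four_zero_two (l : Fin 4 → ℝ) :
    PairForm (invSigma ![c₀, c₁, g ^ 2, 0]) 0 2 l (l 1 * l 3 - g ^ 2) (-(g ^ 2 * (l 1 + l 3) + c₁))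
      (-(g ^ 2 * (l 1 * l 3) + c₁ * (l 1 + l 3) + c₀)) := by
  intro x y
  simp only [invSigma_four, quartic, ne_eq, Fin.reduceEq, not_false_eq_true, Function.update_of_ne,
    Function.update_self]
  ring

theorem pairForm_four_one_three (l : Fin 4 → ℝ) :
    PairForm (invSigma ![c₀, c₁, g ^ 2, 0]) 1 3 l (l 0 * l 2 - g ^ 2) (-(g ^ 2 * (l 0 + l 2) + c₁))
      (-(g ^ 2 * (l 0 * l 2) + c₁ * (l 0 + l 2) + c₀)) := by
  intro x y
  simp only [invSigma_four, quartic, ne_eq, Fin.reduceEq, not_false_eq_true, Function.update_of_ne,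
    Function.update_self]
  ring

theorem pairForm_four_two_three (l : Fin 4 → ℝ) :
    PairForm (invSigma ![c₀, c₁, g ^ 2, 0]) 2 3 l (l 0 * l 1 - g ^ 2) (-(g ^ 2 * (l 0 + l 1) + c₁))
      (-(g ^ 2 * (l 0 * l 1) + c₁ * (l 0 + l 1) + c₀)) := by
  intro x y
  simp only [invSigma_four, quartic, ne_eq, Fin.reduceEq, not_false_eq_true, Function.update_of_ne,
    Function.update_self]
  ring

theorem IsLevelSetOf.inter_quarticRegion_nonempty (h : IsStableQuartic g r c₁ c₀)
    {L : Set (Fin 4 → ℝ)} (hL : IsLevelSetOf (invSigma ![c₀, c₁, g ^ 2, 0]) L) :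
    (L ∩ quarticRegion g c₁).Nonempty := by
  obtain ⟨k, hk⟩ := hL.nonempty
  obtain ⟨x, z, hx, hk'⟩ := hL.exists_update_mem_of_lt (by decide) hk (pairForm_four_zero_two k) g
  obtain ⟨y, w, hy, hl⟩ := hL.exists_update_mem_of_lt (by decide) hk' (pairForm_four_one_three _) g
  set l := Function.update (Function.update (Function.update (Function.update k 0 x) 2 z) 1 y) 3 w
  have h0 : g < l 0 := by simpa [l] using hx
  have h1 : g < l 1 := by simpa [l] using hy
  have hxy : (l 0, l 1) ∈ hyperbolaRegion g :=
    ⟨h.nonneg.trans_lt h0, h.nonneg.trans_lt h1,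
      by simpa [sq] using mul_lt_mul'' h0 h1 h.nonneg h.nonneg⟩
  have hlead := hL.leading_mul_pos (by decide) hl (pairForm_four_two_three l)
  have hpos := pos_of_mul_pos_right hlead (sub_pos.2 hxy.2.2).le
  have hl012 : CubicPos g c₁ (l 0) (l 1) (l 2) := ⟨hxy, by linarith⟩
  exact ⟨l, hl, hl012.mem_quarticRegion h (hL.eq_zero hl).ge⟩

end Quartic

section Alternation

variable {n : ℕ} {v : Fin (n + 1) → ℝ}

theorem zero_lt_neg_one_pow_mul_prod_sub (hv : StrictMono v) (i : Fin (n + 1)) :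
    0 < (-1) ^ (n - i : ℕ) * ∏ j ∈ Finset.univ.erase i, (v i - v j) := by
  have herase : Finset.univ.erase i = (Finset.Ioi i).disjUnion (Finset.Iio i)
      (Finset.disjoint_Ioi_Iio i) := by
    rw [Finset.Ioi_disjUnion_Iio, Finset.compl_singleton]
  have hsub : (-1) ^ (n - i : ℕ) * ∏ j ∈ Finset.Ioi i, (v i - v j) =
      ∏ j ∈ Finset.Ioi i, (v j - v i) := by
    rw [show n - (i : ℕ) = (Finset.Ioi i).card by simp, ← Finset.prod_const,
      ← Finset.prod_mul_distrib]
    exact Finset.prod_congr rfl fun j _ => by ring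
  rw [herase, Finset.prod_disjUnion, ← mul_assoc, hsub]
  exact mul_pos (Finset.prod_pos fun j hj => sub_pos.2 (hv (Finset.mem_Ioi.1 hj)))
    (Finset.prod_pos fun j hj => sub_pos.2 (hv (Finset.mem_Iio.1 hj)))

-- The coefficient is a divided difference, all of whose terms are nonpositive.
theorem coeff_neg_of_alternating (hv : StrictMono v) {P : Polynomial ℝ} (hP : P.degree ≤ n)
    (halt : ∀ i : Fin (n + 1), (-1) ^ (n - i : ℕ) * P.eval (v i) ≤ 0)
    (hlast : P.eval (v (Fin.last n)) < 0) :
    P.coeff n < 0 := by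
  have hcoeff := Lagrange.coeff_eq_sum (s := Finset.univ) hv.injective.injOn (P := P)
    (by simpa using hP.trans_lt (by exact_mod_cast n.lt_succ_self))
  have hterm (i : Fin (n + 1)) : P.eval (v i) / ∏ j ∈ Finset.univ.erase i, (v i - v j) =
      (-1) ^ (n - i : ℕ) * P.eval (v i) /
        ((-1) ^ (n - i : ℕ) * ∏ j ∈ Finset.univ.erase i, (v i - v j)) :=
    (mul_div_mul_left _ _ (by simp)).symm
  rw [Finset.card_univ, Fintype.card_fin, Nat.add_sub_cancel] at hcoeff
  rw [hcoeff]
  refine Finset.sum_neg' (fun i _ => ?_) ⟨Fin.last n, Finset.mem_univ _, ?_⟩ <;> rw [hterm]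
  · exact div_nonpos_of_nonpos_of_nonneg (halt i) (zero_lt_neg_one_pow_mul_prod_sub hv i).le
  · exact div_neg_of_neg_of_pos (by simpa using hlast) (zero_lt_neg_one_pow_mul_prod_sub hv _)

end Alternation

section CubicRoot

variable {g c₁ : ℝ}

theorem strictMonoOn_cube_sub (hg : 0 ≤ g) :
    StrictMonoOn (fun t => t ^ 3 - 3 * g ^ 2 * t) (Set.Ici g) := by
  intro x (hx : g ≤ x) y (hy : g ≤ y) hxy
  have hpos : 0 < x ^ 2 + x * y + y ^ 2 - 3 * g ^ 2 := by
    have hxx := pow_le_pow_left₀ hg hx 2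
    have hgy := pow_lt_pow_left₀ (hx.trans_lt hxy) hg two_ne_zero
    linarith [mul_le_mul hx hy hg (hg.trans hx)]
  dsimp only
  linarith [mul_pos (sub_pos.2 hxy) hpos]

theorem sq_rpow_three_halves (hg : 0 ≤ g) : (g ^ 2) ^ (3 / 2 : ℝ) = g ^ 3 := by
  rw [← Real.rpow_natCast g 2, ← Real.rpow_mul hg, ← Real.rpow_natCast g 3]
  norm_num

theorem le_cos_third_arccos_and_eq (hg : 0 < g) (hc : c₁ ^ 2 ≤ (2 * g ^ 3) ^ 2) {r : ℝ}
    (hr : r = 2 * g * Real.cos (1 / 3 * Real.arccos (c₁ / (2 * g ^ 3)))) :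
    g ≤ r ∧ c₁ = r ^ 3 - 3 * g ^ 2 * r := by
  have hg3 : 0 < 2 * g ^ 3 := by positivity
  obtain ⟨hlower, hupper⟩ := abs_le_of_sq_le_sq' hc hg3.le
  set θ := Real.arccos (c₁ / (2 * g ^ 3))
  have hcos : Real.cos (3 * (1 / 3 * θ)) = c₁ / (2 * g ^ 3) := by
    rw [show 3 * (1 / 3 * θ) = θ by ring]
    exact Real.cos_arccos (by rwa [le_div_iff₀ hg3, neg_one_mul]) ((div_le_one hg3).2 hupper)
  rw [Real.cos_three_mul, eq_div_iff hg3.ne'] at hcos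
  have hhalf : 1 / 2 ≤ Real.cos (1 / 3 * θ) := by
    have hθ₀ : 0 ≤ θ := Real.arccos_nonneg _
    have hθπ : θ ≤ Real.pi := Real.arccos_le_pi _
    rw [← Real.cos_pi_div_three]
    exact Real.cos_le_cos_of_nonneg_of_le_pi (by linarith) (by linarith) (by linarith)
  subst hr
  exact ⟨by linarith [mul_le_mul_of_nonneg_left hhalf hg.le], by linear_combination -hcos⟩

theorem le_cosh_third_arcosh_and_eq (hg : 0 < g) (hc : 2 * g ^ 3 ≤ c₁) {r : ℝ}
    (hr : r = 2 * g * Real.cosh (1 / 3 * Real.arcosh (c₁ / (2 * g ^ 3)))) :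
    g ≤ r ∧ c₁ = r ^ 3 - 3 * g ^ 2 * r := by
  have hg3 : 0 < 2 * g ^ 3 := by positivity
  set θ := Real.arcosh (c₁ / (2 * g ^ 3))
  have hcosh : Real.cosh (3 * (1 / 3 * θ)) = c₁ / (2 * g ^ 3) := by
    rw [show 3 * (1 / 3 * θ) = θ by ring]
    exact Real.cosh_arcosh ((one_le_div hg3).2 hc)
  rw [Real.cosh_three_mul, eq_div_iff hg3.ne'] at hcosh
  have hone : 1 ≤ Real.cosh (1 / 3 * θ) := Real.one_le_cosh _
  subst hr
  exact ⟨by linarith [mul_le_mul_of_nonneg_left hone hg.le], by linear_combination -hcosh⟩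

theorem le_cubicRoot_and_eq (hg : 0 ≤ g) (hc₁ : -2 * g ^ 3 ≤ c₁) :
    g ≤ cubicRoot c₁ (g ^ 2) ∧
      c₁ = cubicRoot c₁ (g ^ 2) ^ 3 - 3 * g ^ 2 * cubicRoot c₁ (g ^ 2) := by
  rw [cubicRoot, sq_rpow_three_halves hg, Real.sqrt_sq hg]
  rcases hg.eq_or_lt with rfl | hg₀
  · have hc : 0 ≤ c₁ := by simpa using hc₁
    have hcube : (c₁ ^ (1 / 3 : ℝ)) ^ 3 = c₁ := by
      simpa using Real.rpow_inv_natCast_pow hc three_ne_zero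
    rw [if_pos (zero_pow two_ne_zero), hcube]
    exact ⟨Real.rpow_nonneg hc _, by ring⟩
  rw [if_neg (pow_pos hg₀ 2).ne']
  split_ifs with hdisc
  · exact le_cos_third_arccos_and_eq hg₀ (by linarith) rfl
  · refine le_cosh_third_arcosh_and_eq hg₀ (not_lt.1 fun hlt => hdisc ?_) rfl
    linarith [sq_le_sq' (show -(2 * g ^ 3) ≤ c₁ by linarith) hlt.le]

theorem isGreatest_cubicRoot (hg : 0 ≤ g) (hc₁ : -2 * g ^ 3 ≤ c₁) :
    IsGreatest {x : ℝ | x ^ 3 - 3 * g ^ 2 * x - c₁ = 0} (cubicRoot c₁ (g ^ 2)) := by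
  obtain ⟨hle, hroot⟩ := le_cubicRoot_and_eq hg hc₁
  refine ⟨sub_eq_zero.2 hroot.symm, fun y hy => not_lt.1 fun hlt => ?_⟩
  have hmono := strictMonoOn_cube_sub hg hle (hle.trans hlt.le) hlt
  exact (hroot.trans_lt hmono).ne' (sub_eq_zero.1 hy)

end CubicRoot

section QuarticConvexity

/-- The point `(x, y, z, w)` lies above the sheet `xyzw = g² σ₂ + c₁ σ₁ + c₀`. Only one of the four
positivity conditions of `quarticRegion` is included: the others follow from it. -/
def QuarticPos (g c₁ c₀ x y z w : ℝ) : Prop :=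
  CubicPos g c₁ x y z ∧ 0 < quartic g c₁ c₀ x y z w

/-- The constant `d` in the equation `(z - c) (w - c) = d`, with `c = hyperbolaCentre g c₁ (x, y)`,
of the fibre over `(x, y)` of the hypersurface `xyzw = g² σ₂ + c₁ σ₁ + c₀`. -/
noncomputable def hyperbolaConstant (g c₁ c₀ : ℝ) (p : ℝ × ℝ) : ℝ :=
  hyperbolaCentre g c₁ p ^ 2 +
    (g ^ 2 * (p.1 * p.2) + c₁ * (p.1 + p.2) + c₀) / (p.1 * p.2 - g ^ 2)

variable {g r c₁ c₀ x y z w p q : ℝ}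

theorem QuarticPos.swap_pairs (h : QuarticPos g c₁ c₀ x y z w) (hs : IsStableQuartic g r c₁ c₀) :
    QuarticPos g c₁ c₀ z w x y := by
  have hc := hs.neg_two_mul_cube_le
  have hrotate : quartic g c₁ c₀ x y z w = quartic g c₁ c₀ z w x y :=
    quartic_rotate.trans quartic_rotate
  exact ⟨((h.1.of_quartic_nonneg hs h.2.le).rotate hc).rotate hc, hrotate ▸ h.2⟩

theorem quartic_eq_mul_hyperbola (hxy : (x, y) ∈ hyperbolaRegion g) :
    quartic g c₁ c₀ x y z w = (x * y - g ^ 2) * ((z - hyperbolaCentre g c₁ (x, y)) *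
      (w - hyperbolaCentre g c₁ (x, y)) - hyperbolaConstant g c₁ c₀ (x, y)) := by
  have hne := (sub_pos.2 hxy.2.2).ne'
  simp only [quartic, hyperbolaConstant, hyperbolaCentre]
  field_simp
  ring

theorem IsStableQuartic.quarticPos_iff (h : IsStableQuartic g r c₁ c₀) :
    QuarticPos g c₁ c₀ x y z w ↔ (x, y) ∈ hyperbolaRegion g ∧ hyperbolaCentre g c₁ (x, y) < z ∧
      hyperbolaCentre g c₁ (x, y) < w ∧ hyperbolaConstant g c₁ c₀ (x, y) <
        (z - hyperbolaCentre g c₁ (x, y)) * (w - hyperbolaCentre g c₁ (x, y)) := by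
  have hquartic (hxy : (x, y) ∈ hyperbolaRegion g) : 0 < quartic g c₁ c₀ x y z w ↔
      hyperbolaConstant g c₁ c₀ (x, y) <
        (z - hyperbolaCentre g c₁ (x, y)) * (w - hyperbolaCentre g c₁ (x, y)) := by
    rw [quartic_eq_mul_hyperbola hxy, mul_pos_iff_of_pos_left (sub_pos.2 hxy.2.2), sub_pos]
  constructor
  · intro hpos
    have hxyw : CubicPos g c₁ x y w := (hpos.1.swap_right h.neg_two_mul_cube_le).of_quartic_nonneg h
      (quartic_swap₂₃ ▸ hpos.2.le)
    exact ⟨hxyw.1, (cubicPos_iff_hyperbolaCentre_lt.1 hpos.1).2,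
      (cubicPos_iff_hyperbolaCentre_lt.1 hxyw).2, (hquartic hxyw.1).1 hpos.2⟩
  · rintro ⟨hxy, hz, -, hd⟩
    exact ⟨cubicPos_iff_hyperbolaCentre_lt.2 ⟨hxy, hz⟩, (hquartic hxy).2 hd⟩

theorem IsStableQuartic.convex_quarticPos_of_diagonal {E : Type*} [AddCommGroup E] [Module ℝ E]
    (h : IsStableQuartic g r c₁ c₀) (φ : E →ₗ[ℝ] ℝ × ℝ)
    (hdiag : Convex ℝ {p : E × ℝ | QuarticPos g c₁ c₀ (φ p.1).1 (φ p.1).2 p.2 p.2}) :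
    Convex ℝ {p : E × ℝ × ℝ | QuarticPos g c₁ c₀ (φ p.1).1 (φ p.1).2 p.2.1 p.2.2} := by
  simp only [h.quarticPos_iff] at hdiag ⊢
  refine convex_hyperbola_fibration (d := fun u => hyperbolaConstant g c₁ c₀ (φ u))
    ((convexOn_hyperbolaCentre h.neg_two_mul_cube_le).comp_linearMap φ) ?_
  convert hdiag using 3 with p
  exact and_congr_right fun _ => ⟨fun hp => ⟨hp.1, hp.1, sq (_ : ℝ) ▸ hp.2⟩,
    fun hp => ⟨hp.1, (sq (_ : ℝ)).symm ▸ hp.2.2⟩⟩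

theorem quartic_diagonal : quartic g c₁ c₀ p p q q = (p * q - g ^ 2) ^ 2 -
    (g ^ 2 * (p + q) ^ 2 + 2 * c₁ * (p + q) + (c₀ + g ^ 4)) := by
  rw [quartic]
  ring

theorem IsStableQuartic.sq_sub_sq_lt (h : IsStableQuartic g r c₁ c₀) {m : ℝ} (hm : 2 * r ≤ m) :
    (r ^ 2 - g ^ 2) ^ 2 < g ^ 2 * m ^ 2 + 2 * c₁ * m + (c₀ + g ^ 4) := by
  have hg := h.nonneg
  have hslope : 0 ≤ g ^ 2 * (m + 2 * r) + 2 * c₁ := by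
    have hr : 0 ≤ r * (r ^ 2 - g ^ 2) :=
      mul_nonneg (hg.trans h.le) (sub_nonneg.2 (pow_le_pow_left₀ hg h.le 2))
    rw [h.coeff_eq]
    linarith [mul_le_mul_of_nonneg_left hm (sq_nonneg g)]
  have hlt := h.lt
  have hc := h.coeff_eq
  have hmono := mul_nonneg (sub_nonneg.2 hm) hslope
  subst hc
  linarith

theorem IsStableQuartic.quartic_diagonal_neg (h : IsStableQuartic g r c₁ c₀) (hpq : g ^ 2 ≤ p * q)
    (hr : 2 * r ≤ p + q) (heq : p * q = g ^ 2 ∨ p + q = 2 * r) :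
    quartic g c₁ c₀ p p q q < 0 := by
  have hQ := h.sq_sub_sq_lt hr
  rw [quartic_diagonal, sub_neg]
  refine lt_of_le_of_lt ?_ hQ
  rcases heq with heq | heq
  · rw [heq, sub_self, zero_pow two_ne_zero]
    positivity
  · refine pow_le_pow_left₀ (sub_nonneg.2 hpq) (sub_le_sub_right ?_ _) 2
    obtain rfl : r = (p + q) / 2 := by linarith
    linarith [sq_nonneg (p - q)]

theorem QuarticPos.two_mul_lt_add (h : QuarticPos g c₁ c₀ p p q q)
    (hs : IsStableQuartic g r c₁ c₀) : 2 * r < p + q := by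
  have hpp := h.1.2
  have hqq := (h.swap_pairs hs).1.2
  obtain ⟨hp, hq, hpq⟩ := h.1.mem_right hs.neg_two_mul_cube_le
  have hm := two_mul_lt_add_of_mem_hyperbolaRegion ⟨hp, hq, hpq⟩
  by_contra! hle
  rw [hs.coeff_eq] at hpp hqq
  have hg := hs.nonneg
  have hpos : 0 ≤ r ^ 2 + r * ((p + q) / 2) + ((p + q) / 2) ^ 2 - 3 * g ^ 2 := by
    have hm' : g ≤ (p + q) / 2 := by linarith
    linarith [pow_le_pow_left₀ hg hs.le 2, pow_le_pow_left₀ hg hm' 2,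
      mul_le_mul hs.le hm' hg (hg.trans hs.le)]
  linarith [mul_nonneg (sub_nonneg.2 hle) hpos, mul_nonneg (add_pos hp hq).le (sq_nonneg (p - q))]

theorem QuarticPos.exists_quartic_neg (h : QuarticPos g c₁ c₀ p p q q)
    (hs : IsStableQuartic g r c₁ c₀) {α β : ℝ} (hβ : 0 < β) :
    ∃ t > 0, quartic g c₁ c₀ (p + α * t) (p + α * t) (q - β * t) (q - β * t) < 0 := by
  obtain ⟨-, hq, hpq⟩ := h.1.mem_right hs.neg_two_mul_cube_le
  let μ : ℝ → ℝ := fun t => min ((p + α * t) * (q - β * t) - g ^ 2)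
    ((p + α * t) + (q - β * t) - 2 * r)
  have hμ : Continuous μ := by fun_prop
  have hμ₀ : 0 < μ 0 := by simpa [μ] using ⟨hpq, h.two_mul_lt_add hs⟩
  have hμ₁ : μ (q / β) ≤ 0 := by
    refine (min_le_left _ _).trans ?_
    rw [mul_div_cancel₀ q hβ.ne', sub_self, mul_zero, zero_sub]
    exact neg_nonpos.2 (sq_nonneg g)
  obtain ⟨t, ⟨ht, -⟩, hμt⟩ := intermediate_value_Icc' (div_pos hq hβ).le hμ.continuousOn
    ⟨hμ₁, hμ₀.le⟩
  have ht₀ : t ≠ 0 := fun h0 => hμ₀.ne' (h0 ▸ hμt)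
  refine ⟨t, lt_of_le_of_ne ht ht₀.symm, hs.quartic_diagonal_neg
    (sub_nonneg.1 (hμt.ge.trans (min_le_left _ _)))
    (sub_nonneg.1 (hμt.ge.trans (min_le_right _ _))) ?_⟩
  exact (min_choice _ _).imp (fun h0 => sub_eq_zero.1 (h0.symm.trans hμt))
    fun h0 => sub_eq_zero.1 (h0.symm.trans hμt)

theorem exists_polynomial_quartic_line (g c₁ c₀ p q α β : ℝ) : ∃ P : Polynomial ℝ,
    (∀ t, P.eval t = quartic g c₁ c₀ (p + α * t) (p + α * t) (q - β * t) (q - β * t)) ∧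
      P.degree ≤ 4 ∧ P.coeff 4 = (α * β) ^ 2 := by
  refine ⟨((.C p + .C α * .X) * (.C q - .C β * .X) - .C (g ^ 2)) ^ 2 -
    (.C (g ^ 2) * ((.C p + .C α * .X) + (.C q - .C β * .X)) ^ 2 +
      .C (2 * c₁) * ((.C p + .C α * .X) + (.C q - .C β * .X)) + .C (c₀ + g ^ 4)),
    fun t => ?_, ?_, ?_⟩
  · simp [quartic_diagonal]
  · compute_degree
  · compute_degree <;> norm_num

-- On the line the quartic would have the signs `-`, `+`, `≤ 0`, `+`, `-`.
theorem QuarticPos.quartic_pos_of_segment (hs : IsStableQuartic g r c₁ c₀) {α β : ℝ} (hα : 0 < α)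
    (hβ : 0 < β) (h : QuarticPos g c₁ c₀ p p q q)
    (h' : QuarticPos g c₁ c₀ (p + α) (p + α) (q - β) (q - β)) {t : ℝ} (ht : 0 < t) (ht' : t < 1) :
    0 < quartic g c₁ c₀ (p + α * t) (p + α * t) (q - β * t) (q - β * t) := by
  obtain ⟨P, hP, hdeg, hcoeff⟩ := exists_polynomial_quartic_line g c₁ c₀ p q α β
  obtain ⟨a, ha, hneg⟩ := (h.swap_pairs hs).exists_quartic_neg hs (α := β) hα
  obtain ⟨b, hb, hneg'⟩ := h'.exists_quartic_neg hs (α := α) hβ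
  have hPa : P.eval (-a) < 0 := by
    rw [hP, ← quartic_rotate, ← quartic_rotate]
    simpa only [mul_neg, sub_neg_eq_add, ← sub_eq_add_neg] using hneg
  have hPb : P.eval (1 + b) < 0 := by
    rw [hP]
    simpa only [mul_add, mul_one, ← add_assoc, ← sub_sub] using hneg'
  have hP₀ : 0 < P.eval 0 := by simpa [hP] using h.2
  have hP₁ : 0 < P.eval 1 := by simpa [hP] using h'.2
  rw [← hP]
  by_contra! hPt
  have hmono : StrictMono ![-a, 0, t, 1, 1 + b] := by
    simp [Fin.strictMono_iff_lt_succ, Fin.forall_fin_succ, *]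
  have hlt := coeff_neg_of_alternating hmono (P := P) (mod_cast hdeg) ?_ hPb
  · rw [hcoeff] at hlt
    exact (sq_nonneg (α * β)).not_gt hlt
  · intro i
    fin_cases i
    exacts [by simpa [pow_succ] using hPa.le, by simpa [pow_succ] using hP₀.le,
      by simpa using hPt, by simpa using hP₁.le, by simpa using hPb.le]

theorem QuarticPos.mono (h : QuarticPos g c₁ c₀ x y z w) (hs : IsStableQuartic g r c₁ c₀)
    {x' y' z' w' : ℝ} (hx : x ≤ x') (hy : y ≤ y') (hz : z ≤ z') (hw : w ≤ w') :
    QuarticPos g c₁ c₀ x' y' z' w' := by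
  have hc := hs.neg_two_mul_cube_le
  refine ⟨h.1.mono hc hx hy hz, h.2.trans_le (quartic_le_quartic hc h.1 ?_ ?_ ?_ hx hy hz hw)⟩
  · exact (h.1.swap_right hc).of_quartic_nonneg hs (quartic_swap₂₃ ▸ h.2.le)
  · exact h.1.of_quartic_nonneg hs h.2.le
  · exact h.1.swap.of_quartic_nonneg hs (quartic_swap₁₂ ▸ h.2.le)

theorem QuarticPos.convex_combination (hs : IsStableQuartic g r c₁ c₀) {p' q' : ℝ}
    (h : QuarticPos g c₁ c₀ p p q q) (h' : QuarticPos g c₁ c₀ p' p' q' q') (hp : p ≤ p') {a b : ℝ}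
    (ha : 0 < a) (hb : 0 < b) (hab : a + b = 1) :
    QuarticPos g c₁ c₀ (a * p + b * p') (a * p + b * p') (a * q + b * q') (a * q + b * q') := by
  obtain rfl : a = 1 - b := by linarith
  rw [show (1 - b) * p + b * p' = p + (p' - p) * b by ring,
    show (1 - b) * q + b * q' = q - (q - q') * b by ring]
  have hp_le : p ≤ p + (p' - p) * b :=
    le_add_of_nonneg_right (mul_nonneg (sub_nonneg.2 hp) hb.le)
  rcases le_or_gt q q' with hq | hq
  · have hq_le : q ≤ q - (q - q') * b :=
      le_sub_self_iff _ |>.2 (mul_nonpos_of_nonpos_of_nonneg (sub_nonpos.2 hq) hb.le)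
    exact h.mono hs hp_le hp_le hq_le hq_le
  rcases hp.eq_or_lt with rfl | hlt
  · have hq_le : q' ≤ q - (q - q') * b := by linarith [mul_nonneg ha.le (sub_pos.2 hq).le]
    exact h'.mono hs hp_le hp_le hq_le hq_le
  · have hcubic := convex_cubicPos hs.neg_two_mul_cube_le (x := ((p, p), q)) h.1
      (y := ((p', p'), q')) h'.1 ha.le hb.le hab
    simp only [Set.mem_ofPred_eq, Prod.fst_add, Prod.snd_add, Prod.smul_fst, Prod.smul_snd,
      smul_eq_mul] at hcubic
    refine ⟨?_, QuarticPos.quartic_pos_of_segment hs (sub_pos.2 hlt) (sub_pos.2 hq) h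
      (by simpa using h') hb (by linarith)⟩
    convert hcubic using 1 <;> ring

theorem IsStableQuartic.convex_diagonal_quarticPos (h : IsStableQuartic g r c₁ c₀) :
    Convex ℝ {u : ℝ × ℝ | QuarticPos g c₁ c₀ u.1 u.1 u.2 u.2} := by
  refine convex_iff_forall_pos.2 fun u hu v hv a b ha hb hab => ?_
  rcases le_total u.1 v.1 with huv | hvu
  · exact QuarticPos.convex_combination h hu hv huv ha hb hab
  · have := QuarticPos.convex_combination h hv hu hvu hb ha (by linarith)
    simpa only [Set.mem_ofPred_eq, Prod.fst_add, Prod.snd_add, Prod.smul_fst, Prod.smul_snd,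
      smul_eq_mul, add_comm] using this

theorem IsStableQuartic.convex_quarticPos (h : IsStableQuartic g r c₁ c₀) :
    Convex ℝ {u : (ℝ × ℝ) × ℝ × ℝ | QuarticPos g c₁ c₀ u.1.1 u.1.2 u.2.1 u.2.2} := by
  refine h.convex_quarticPos_of_diagonal LinearMap.id ?_
  have hdiag := h.convex_quarticPos_of_diagonal (LinearMap.id.prod LinearMap.id)
    h.convex_diagonal_quarticPos
  have hswap : {u : (ℝ × ℝ) × ℝ | QuarticPos g c₁ c₀ u.1.1 u.1.2 u.2 u.2} =
      {u | QuarticPos g c₁ c₀ u.2 u.2 u.1.1 u.1.2} :=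
    Set.ext fun u => ⟨fun hu => hu.swap_pairs h, fun hu => hu.swap_pairs h⟩
  exact hswap ▸ hdiag.is_linear_preimage (f := fun u : (ℝ × ℝ) × ℝ => (u.2, u.1))
    ⟨fun _ _ => rfl, fun _ _ => rfl⟩

theorem IsStableQuartic.quarticRegion_inter_pos (h : IsStableQuartic g r c₁ c₀) :
    quarticRegion g c₁ ∩ {l | 0 < invSigma ![c₀, c₁, g ^ 2, 0] l} =
      {l | QuarticPos g c₁ c₀ (l 0) (l 1) (l 2) (l 3)} := by
  ext l
  constructor
  · exact fun hl => ⟨hl.1.1, invSigma_four l ▸ hl.2⟩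
  · intro hl
    have hpos : 0 < invSigma ![c₀, c₁, g ^ 2, 0] l := by rw [invSigma_four]; exact hl.2
    exact ⟨hl.1.mem_quarticRegion h hpos.le, hpos⟩

theorem IsStableQuartic.const_mem_quarticRegion (h : IsStableQuartic g r c₁ c₀) {t : ℝ}
    (ht : r < t) : (fun _ => t) ∈ quarticRegion g c₁ := by
  have hgt : g < t := h.le.trans_lt ht
  have ht₀ : 0 < t := h.nonneg.trans_lt hgt
  have hmono := strictMonoOn_cube_sub h.nonneg h.le hgt.le ht
  have hpos : CubicPos g c₁ t t t := by
    refine ⟨⟨ht₀, ht₀, by simpa [sq] using mul_self_lt_mul_self h.nonneg hgt⟩, ?_⟩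
    rw [h.coeff_eq]
    linarith
  exact ⟨hpos, hpos, hpos, hpos⟩

theorem IsStableQuartic.hasConvexLevelSet (h : IsStableQuartic g r c₁ c₀) :
    HasConvexLevelSet (invSigma ![c₀, c₁, g ^ 2, 0]) := by
  refine h.isGrowthRegion_quarticRegion.hasConvexLevelSet_invSigma
    (fun L hL => hL.inter_quarticRegion_nonempty h) (r := r) ?_
    (fun t ht => h.const_mem_quarticRegion ht) ?_
  · rw [invSigma_four, quartic]
    have hr : c₁ * r = (r ^ 3 - 3 * g ^ 2 * r) * r := by rw [← h.coeff_eq]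
    linarith [h.lt]
  · rw [h.quarticRegion_inter_pos]
    exact h.convex_quarticPos.is_linear_preimage
      (f := fun l : Fin 4 → ℝ => ((l 0, l 1), (l 2, l 3))) ⟨fun _ _ => rfl, fun _ _ => rfl⟩

end QuarticConvexity

theorem proposition4p1 :
    -- degree two: `l₁ l₂ - c₀ = 0`
    (∀ c₀ : ℝ, 0 < c₀ → HasConvexLevelSet (invSigma ![c₀, 0])) ∧
    -- degree three: `l₁ l₂ l₃ - c₁ σ₁(l) - c₀ = 0`
    (∀ c₀ c₁ : ℝ, 0 ≤ c₁ → -2 * c₁ ^ (3 / 2 : ℝ) < c₀ →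
      HasConvexLevelSet (invSigma ![c₀, c₁, 0])) ∧
    -- degree four: `l₁ l₂ l₃ l₄ - c₂ σ₂(l) - c₁ σ₁(l) - c₀ = 0`
    (∀ c₁ c₂ : ℝ, 0 ≤ c₂ → -2 * c₂ ^ (3 / 2 : ℝ) ≤ c₁ →
      IsGreatest {x : ℝ | x ^ 3 - 3 * c₂ * x - c₁ = 0} (cubicRoot c₁ c₂) ∧
      ∀ c₀ : ℝ, -3 * c₂ * cubicRoot c₁ c₂ ^ 2 - 3 * c₁ * cubicRoot c₁ c₂ < c₀ →
        HasConvexLevelSet (invSigma ![c₀, c₁, c₂, 0])) := by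
  refine ⟨fun c₀ => hasConvexLevelSet_two, fun c₀ c₁ hc₁ hc₀ => ?_, fun c₁ c₂ hc₂ hc₁ => ?_⟩
  · obtain ⟨g, hg, rfl⟩ : ∃ g, 0 ≤ g ∧ g ^ 2 = c₁ := ⟨√c₁, Real.sqrt_nonneg _, Real.sq_sqrt hc₁⟩
    rw [sq_rpow_three_halves hg] at hc₀
    exact hasConvexLevelSet_three hg hc₀
  · obtain ⟨g, hg, rfl⟩ : ∃ g, 0 ≤ g ∧ g ^ 2 = c₂ := ⟨√c₂, Real.sqrt_nonneg _, Real.sq_sqrt hc₂⟩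
    rw [sq_rpow_three_halves hg] at hc₁
    obtain ⟨hle, hroot⟩ := le_cubicRoot_and_eq hg hc₁
    exact ⟨isGreatest_cubicRoot hg hc₁, fun c₀ hc₀ =>
      IsStableQuartic.hasConvexLevelSet ⟨hg, hle, hroot, hc₀⟩⟩
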